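/- Let $\mathcal N$ be the family of all Gaussian densities on $\mathbb R$ (of positive variance), in the natural parameters $\theta=(\theta_1,\theta_2)=(\mu/\sigma^2,-1/(2\sigma^2))\in\mathbb R\times(-\infty,0)$, with the Fisher metric $h_F$, $(h_F)_{ij}=\mathbb E_{p_\theta}[\partial_i\ln p_\theta\,\partial_j\ln p_\theta]$, and the exponential connection $\nabla^{(e)}$, $h_F(\nabla^{(e)}_{\partial_i}\partial_j,\partial_k)=\mathbb E_{p_\theta}[(\partial_i\partial_j\ln p_\theta)\,\partial_k\ln p_\theta]$. Let $(g,J)$ be the metric and almost complex structure on $T\mathcal N$ given by Dombrowski's construction: writing a tangent vector of $T\mathcal N$ at a point over $p$ as a pair $(v,w)\in T_p\mathcal N\times T_p\mathcal N$ (the horizontal and the vertical component for $\nabla^{(e)}$), $$g\big((v,w),(v',w')\big)=h_F(v,v')+h_F(w,w'),\qquad J(v,w)=(-w,v).$$ Let $(\theta,\dot\theta)$ be the induced global coordinates on $T\mathcal N$ and $z_k=\theta_k+i\dot\theta_k$. Let $\mathbb H=\{\tau\in\mathbb C : \operatorname{Im}\tau>0\}$, and let $\mathbb S^J$ be the complex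 manifold $\mathbb H\times\mathbb C$ with the metric $g_{KB}$ which in the coordinates $\tau=u+iv$, $z=x+iy$ is $$g_{KB}=\tfrac12\Big(\tfrac{v+y^2}{v^3}(du^2+dv^2)-\tfrac{2y}{v^2}(du\,dx+dv\,dy)+\tfrac1v(dx^2+dy^2)\Big).$$ Let $\mathrm{ASp}(2,\mathbb R)=\mathrm{SL}(2,\mathbb R)\ltimes\mathbb R^2$ have the multiplication $(M_1,X_1)(M_2,X_2)=(M_1M_2,X_1M_2+X_2)$ ($X_i$ row vectors); it acts on the left on $\mathbb H\times\mathbb C$ by $$\Big(\begin{bmatrix}a&b\\c&d\end{bmatrix},(\lambda,\mu)\Big)\cdot(\tau,z)=\Big(\frac{a\tau+b}{c\tau+d},\frac{z+\lambda\tau+\mu}{c\tau+d}\Big).$$ **Theorem.** The map $f:T\mathcal N\to\mathbb S^J$, $(z_1,z_2)\mapsto(\tau,z)=(-iz_2,iz_1)$, is a diffeomorphism with $f^*g_{KB}=g$ and $f_*J=if_*$. The action of $\mathrm{ASp}(2,\mathbb R)$ on $T\mathcal N$ obtained through $f$ is effective. The group of holomorphic isometries of $T\mathcal N$, that is, of all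 diffeomorphisms $\varphi$ of $T\mathcal N$ with $\varphi^*g=g$ and $\varphi_*J=J\varphi_*$, is exactly the image of $\mathrm{ASp}(2,\mathbb R)$ in the group of diffeomorphisms of $T\mathcal N$ under this action (and so is isomorphic to $\mathrm{ASp}(2,\mathbb R)$). -/

import Mathlib

open MeasureTheory UpperHalfPlane
open scoped Manifold ContDiff MatrixGroups Matrix

noncomputable section

/-! ## Holomorphic isometries of an almost Hermitian manifold -/

/-- The group of holomorphic isometries of a manifold `M` carrying a metric `g` and an almost
complex structure `J`: all diffeomorphisms `φ` of `M` with `φ^* g = g` and `φ_* J = J φ_*`. -/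
def holomorphicIsometryGroup {E H M : Type*} [NormedAddCommGroup E] [NormedSpace ℝ E]
    [TopologicalSpace H] (I : ModelWithCorners ℝ E H) [TopologicalSpace M] [ChartedSpace H M]
    (g : ∀ p : M, TangentSpace I p → TangentSpace I p → ℝ)
    (J : ∀ p : M, TangentSpace I p → TangentSpace I p) : Subgroup (Equiv.Perm M) where
  carrier := {φ | ContMDiff I I ∞ φ ∧ ContMDiff I I ∞ φ.symm ∧
    (∀ (p : M) (X Y : TangentSpace I p),
      g (φ p) (mfderiv I I φ p X) (mfderiv I I φ p Y) = g p X Y) ∧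
    ∀ (p : M) (X : TangentSpace I p), mfderiv I I φ p (J p X) = J (φ p) (mfderiv I I φ p X)}
  one_mem' := by
    refine ⟨contMDiff_id, contMDiff_id, fun p X Y => ?_, fun p X => ?_⟩
    · change g p (mfderiv I I id p X) (mfderiv I I id p Y) = g p X Y
      rw [mfderiv_id]; rfl
    · change mfderiv I I id p (J p X) = J p (mfderiv I I id p X)
      rw [mfderiv_id]; rfl
  mul_mem' := by
    rintro φ ψ ⟨h1, h2, h3, h4⟩ ⟨k1, k2, k3, k4⟩
    have hc : ∀ p, mfderiv I I (φ * ψ : Equiv.Perm M) p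
        = (mfderiv I I φ (ψ p)).comp (mfderiv I I ψ p) := fun p =>
      mfderiv_comp p (h1.mdifferentiable (by simp) _) (k1.mdifferentiable (by simp) _)
    refine ⟨h1.comp k1, k2.comp h2, fun p X Y => ?_, fun p X => ?_⟩
    · rw [hc]
      exact (h3 (ψ p) _ _).trans (k3 p X Y)
    · rw [hc]
      exact (congrArg (mfderiv I I φ (ψ p)) (k4 p X)).trans (h4 (ψ p) _)
  inv_mem' := by
    rintro φ ⟨h1, h2, h3, h4⟩
    have hc : ∀ p (X : TangentSpace I p),
        mfderiv I I φ (φ.symm p) (mfderiv I I φ.symm p X) = X := by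
      intro p X
      have h := mfderiv_comp p (h1.mdifferentiable (by simp) (φ.symm p))
        (h2.mdifferentiable (by simp) p)
      have hid : (φ ∘ φ.symm : M → M) = id := by ext; simp
      rw [hid, mfderiv_id] at h
      exact (congrArg (fun L => L X) h).symm
    have hc' : ∀ p (X : TangentSpace I (φ.symm p)),
        mfderiv I I φ.symm (φ (φ.symm p)) (mfderiv I I φ (φ.symm p) X) = X := by
      intro p X
      have h := mfderiv_comp (φ.symm p) (h2.mdifferentiable (by simp) (φ (φ.symm p)))
        (h1.mdifferentiable (by simp) (φ.symm p))
      have hid : (φ.symm ∘ φ : M → M) = id := by ext; simp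
      rw [hid, mfderiv_id] at h
      exact (congrArg (fun L => L X) h).symm
    have hg : ∀ (p q : M) (X Y : E), q = p → g q X Y = g p X Y := by
      rintro p _ X Y rfl; rfl
    have hJ : ∀ (p q : M) (X : E), q = p → (J q X : E) = J p X := by
      rintro p _ X rfl; rfl
    have hd : ∀ (p q : M) (X : E), q = p →
        (mfderiv I I φ.symm q X : E) = mfderiv I I φ.symm p X := by
      rintro p _ X rfl; rfl
    refine ⟨h2, h1, fun p X Y => ?_, fun p X => ?_⟩
    · have h := h3 (φ.symm p) (mfderiv I I φ.symm p X) (mfderiv I I φ.symm p Y)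
      rw [hc, hc] at h
      exact h.symm.trans (hg p _ X Y (φ.apply_symm_apply p))
    · have h := h4 (φ.symm p) (mfderiv I I φ.symm p X)
      rw [hc] at h
      have h' := hc' p (J (φ.symm p) (mfderiv I I φ.symm p X))
      have e1 := hd p _ (mfderiv I I φ (φ.symm p)
        (J (φ.symm p) (mfderiv I I φ.symm p X))) (φ.apply_symm_apply p)
      have e2 : (mfderiv I I φ (φ.symm p) (J (φ.symm p) (mfderiv I I φ.symm p X)) : E) = J p X :=
        Eq.trans h (hJ p _ X (φ.apply_symm_apply p))
      exact (congrArg (fun Y : E => (mfderiv I I φ.symm p Y : E)) e2).symm.trans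
        (e1.symm.trans h')

/-! ## Statistical models: Fisher metric and exponential connection -/

section Information

variable {n : ℕ} {Ω : Type*} [MeasurableSpace Ω]

/-- The `i`-th partial derivative of a function on `ℝⁿ`. -/
def partialDeriv (i : Fin n) (F : (Fin n → ℝ) → ℝ) (θ : Fin n → ℝ) : ℝ :=
  fderiv ℝ F θ (Pi.single i 1)

/-- The function `∂ᵢ ln p_θ` on the sample space, for a family `p` of densities. -/
def score (p : (Fin n → ℝ) → Ω → ℝ) (i : Fin n) (θ : Fin n → ℝ) (x : Ω) : ℝ :=
  partialDeriv i (fun t => Real.log (p t x)) θ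

/-- The matrix of the Fisher metric, `(h_F)_{ij} = E_{p_θ}[∂ᵢ ln p_θ · ∂ⱼ ln p_θ]`. -/
def fisherMatrix (m : Measure Ω) (p : (Fin n → ℝ) → Ω → ℝ) (θ : Fin n → ℝ) :
    Matrix (Fin n) (Fin n) ℝ :=
  Matrix.of fun i j => ∫ x, score p i θ x * score p j θ x * p θ x ∂m

/-- `Γ_{ij,k}` of the exponential connection (the `α`-connection with `α = 1`):
`E_{p_θ}[(∂ᵢ ∂ⱼ ln p_θ) · ∂ₖ ln p_θ]`. -/
def exponentialLower (m : Measure Ω) (p : (Fin n → ℝ) → Ω → ℝ) (θ : Fin n → ℝ)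
    (i j k : Fin n) : ℝ :=
  ∫ x, partialDeriv i (fun t => score p j t x) θ * score p k θ x * p θ x ∂m

/-- The Christoffel symbols `Γ_{ij}^k` of the exponential connection, obtained from
`Γ_{ij,l} = h_F (∇_{∂ᵢ} ∂ⱼ, ∂ₗ)` by raising the index with the Fisher metric. -/
def exponentialChristoffel (m : Measure Ω) (p : (Fin n → ℝ) → Ω → ℝ) (θ : Fin n → ℝ)
    (i j k : Fin n) : ℝ :=
  ∑ l, (fisherMatrix m p θ)⁻¹ k l * exponentialLower m p θ i j l

end Information

/-! ## Dombrowski's construction on the tangent bundle of an open subset of `ℝⁿ`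

The tangent bundle of an open set `Θ ⊆ ℝⁿ` is the open subset `Θ × ℝⁿ` of `ℝⁿ × ℝⁿ`, with points
`(θ, θ')`; a tangent vector to it is a pair `(c, d) ∈ ℝⁿ × ℝⁿ`. -/

section Dombrowski

variable {n : ℕ}

/-- The tangent bundle `Θ × ℝⁿ` of the open set `Θ ⊆ ℝⁿ`. -/
def tangentDomain (Θ : TopologicalSpace.Opens (Fin n → ℝ)) :
    TopologicalSpace.Opens ((Fin n → ℝ) × (Fin n → ℝ)) :=
  ⟨{u | u.1 ∈ Θ}, Θ.isOpen.preimage continuous_fst⟩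

/-- The bilinear map `(Γ_θ(b, c))ₖ = ∑ Γ_{ij}^k(θ) bⱼ cᵢ` of a connection with Christoffel
symbols `Γ`. -/
def christoffelMap (Γ : (Fin n → ℝ) → Fin n → Fin n → Fin n → ℝ) (θ b c : Fin n → ℝ) :
    Fin n → ℝ :=
  fun k => ∑ i, ∑ j, Γ θ i j k * b j * c i

/-- The splitting `A ↦ (π_* A, K A)` of a tangent vector at the point `u` of the tangent bundle into
its horizontal and vertical parts; `K (c, d) = d + Γ_θ(θ', c)` is the connector. -/
def connectionSplit (Γ : (Fin n → ℝ) → Fin n → Fin n → Fin n → ℝ)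
    (u A : (Fin n → ℝ) × (Fin n → ℝ)) : (Fin n → ℝ) × (Fin n → ℝ) :=
  (A.1, A.2 + christoffelMap Γ u.1 u.2 A.1)

/-- The inverse of `connectionSplit`: the tangent vector with horizontal part `B.1` and vertical
part `B.2`. -/
def connectionJoin (Γ : (Fin n → ℝ) → Fin n → Fin n → Fin n → ℝ)
    (u B : (Fin n → ℝ) × (Fin n → ℝ)) : (Fin n → ℝ) × (Fin n → ℝ) :=
  (B.1, B.2 - christoffelMap Γ u.1 u.2 B.1)

/-- Dombrowski's metric `g((v, w), (v', w')) = h(v, v') + h(w, w')`. -/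
def dombrowskiMetric (h : (Fin n → ℝ) → Matrix (Fin n) (Fin n) ℝ)
    (Γ : (Fin n → ℝ) → Fin n → Fin n → Fin n → ℝ)
    (u A B : (Fin n → ℝ) × (Fin n → ℝ)) : ℝ :=
  (connectionSplit Γ u A).1 ⬝ᵥ h u.1 *ᵥ (connectionSplit Γ u B).1 +
    (connectionSplit Γ u A).2 ⬝ᵥ h u.1 *ᵥ (connectionSplit Γ u B).2

/-- Dombrowski's almost complex structure `J(v, w) = (-w, v)`. -/
def dombrowskiJ (Γ : (Fin n → ℝ) → Fin n → Fin n → Fin n → ℝ)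
    (u A : (Fin n → ℝ) × (Fin n → ℝ)) : (Fin n → ℝ) × (Fin n → ℝ) :=
  connectionJoin Γ u (-(connectionSplit Γ u A).2, (connectionSplit Γ u A).1)

end Dombrowski

/-! ## The Gaussian family `𝒩` and the Kähler manifold `T𝒩`

`𝒩` is the set of Gaussian densities on `ℝ`. The natural parameters `θ₁ = μ/σ²`,
`θ₂ = -1/(2σ²)` (components `θ 0` and `θ 1` below) form a global chart, through which `𝒩` is the
half-plane `θ₂ < 0`. -/

/-- The range `{θ | θ₂ < 0}` of the natural parameters of the Gaussian family. -/
def gaussianDomain : TopologicalSpace.Opens (Fin 2 → ℝ) :=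
  ⟨{θ | θ 1 < 0}, isOpen_lt (continuous_apply 1) continuous_const⟩

/-- The Gaussian density with natural parameter `θ`, as an exponential family:
`exp (θ₁ x + θ₂ x² - ψ(θ))` with `ψ(θ) = -θ₁²/(4θ₂) + (1/2) ln (-π/θ₂)`. -/
def gaussianDensity (θ : Fin 2 → ℝ) (x : ℝ) : ℝ :=
  Real.exp (θ 0 * x + θ 1 * x ^ 2 -
    (-(θ 0) ^ 2 / (4 * θ 1) + 1 / 2 * Real.log (-Real.pi / θ 1)))

/-- `θ ↦ p_θ` is a bijection from the parameter half-plane onto the set of all Gaussian densities of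
positive variance. -/
theorem gaussianDensity_bijOn : Set.BijOn gaussianDensity gaussianDomain
    {p | ∃ (a : ℝ) (v : NNReal), v ≠ 0 ∧ p = ProbabilityTheory.gaussianPDFReal a v} := by
  have key : ∀ θ : Fin 2 → ℝ, θ 1 < 0 → gaussianDensity θ =
      ProbabilityTheory.gaussianPDFReal (-θ 0 / (2 * θ 1)) (Real.toNNReal (-1 / (2 * θ 1))) := by
    intro θ h
    have h0 : θ 1 ≠ 0 := h.ne
    have hv : 0 < -1 / (2 * θ 1) := div_pos_of_neg_of_neg (by norm_num) (by linarith)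
    funext x
    have hpi : 0 < -Real.pi / θ 1 := div_pos_of_neg_of_neg (by linarith [Real.pi_pos]) h
    rw [ProbabilityTheory.gaussianPDFReal, Real.coe_toNNReal _ hv.le, gaussianDensity]
    have e : 2 * Real.pi * (-1 / (2 * θ 1)) = -Real.pi / θ 1 := by field_simp
    rw [e, Real.sqrt_eq_rpow, Real.rpow_def_of_pos hpi, ← Real.exp_neg, ← Real.exp_add]
    congr 1
    field_simp
    ring
  refine ⟨fun θ h => ⟨_, _, ?_, key θ h⟩, fun θ h θ' h' e => ?_, ?_⟩
  · have h : θ 1 < 0 := h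
    have hv : 0 < -1 / (2 * θ 1) := div_pos_of_neg_of_neg (by norm_num) (by linarith)
    exact (Real.toNNReal_pos.2 hv).ne'
  · have e0 := congrFun e 0
    have e1 := congrFun e 1
    have e2 := congrFun e (-1)
    simp only [gaussianDensity, Real.exp_eq_exp] at e0 e1 e2
    funext i
    fin_cases i
    · change θ 0 = θ' 0
      linarith
    · change θ 1 = θ' 1
      linarith
  · rintro p ⟨a, v, hv, rfl⟩
    have hv' : (0 : ℝ) < v := lt_of_le_of_ne v.2 (fun h => hv (NNReal.eq h.symm))
    have hneg : -1 / (2 * (v : ℝ)) < 0 := div_neg_of_neg_of_pos (by norm_num) (by linarith)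
    refine ⟨![a / v, -1 / (2 * v)], hneg, ?_⟩
    rw [key _ hneg]
    congr 1
    · simp only [Matrix.cons_val_zero, Matrix.cons_val_one]
      field_simp
    · apply NNReal.eq
      rw [Real.coe_toNNReal _ (div_pos_of_neg_of_neg (by norm_num)
        (by simp only [Matrix.cons_val_one, Matrix.cons_val_zero]; linarith)).le]
      simp only [Matrix.cons_val_one, Matrix.cons_val_zero]
      field_simp

/-- The tangent bundle `T𝒩`, with its global coordinates `(θ, θ')`. -/
abbrev TN : Type := tangentDomain gaussianDomain

/-- The exponential connection of the Gaussian family. -/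
def gaussianGamma : (Fin 2 → ℝ) → Fin 2 → Fin 2 → Fin 2 → ℝ :=
  exponentialChristoffel volume gaussianDensity

/-- The metric of `T𝒩`: Dombrowski's construction for the Fisher metric and the exponential
connection. -/
def metricTN (u : TN) (A B : TangentSpace 𝓘(ℝ, (Fin 2 → ℝ) × (Fin 2 → ℝ)) u) : ℝ :=
  dombrowskiMetric (fisherMatrix volume gaussianDensity) gaussianGamma u.1 A B

/-- The complex structure of `T𝒩`: Dombrowski's construction for the exponential connection. -/
def complexStructureTN (u : TN) (A : TangentSpace 𝓘(ℝ, (Fin 2 → ℝ) × (Fin 2 → ℝ)) u) :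
    TangentSpace 𝓘(ℝ, (Fin 2 → ℝ) × (Fin 2 → ℝ)) u :=
  dombrowskiJ gaussianGamma u.1 A

/-- The group of holomorphic isometries of `T𝒩`. -/
def holomorphicIsometriesTN : Subgroup (Equiv.Perm TN) :=
  holomorphicIsometryGroup 𝓘(ℝ, (Fin 2 → ℝ) × (Fin 2 → ℝ)) metricTN complexStructureTN

/-! ## The Siegel-Jacobi space `S^J` -/

/-- The matrix of the Kähler-Berndt metric `g_{A,B}` at `(τ, z)`, `τ = u + iv`, `z = x + iy`, in the
real coordinates `(u, v, x, y)` of `ℍ × ℂ`. -/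
def kaehlerBerndtMatrix (A B : ℝ) (q : ℍ × ℂ) : Matrix (Fin 4) (Fin 4) ℝ :=
  let v := q.1.im
  let y := q.2.im
  !![(A * v + B * y ^ 2) / v ^ 3, 0, -(B * y / v ^ 2), 0;
     0, (A * v + B * y ^ 2) / v ^ 3, 0, -(B * y / v ^ 2);
     -(B * y / v ^ 2), 0, B / v, 0;
     0, -(B * y / v ^ 2), 0, B / v]

/-- The components of a tangent vector to `ℍ × ℂ` in the real coordinates `(u, v, x, y)`. -/
def realCoords (X : ℂ × ℂ) : Fin 4 → ℝ := ![X.1.re, X.1.im, X.2.re, X.2.im]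

/-- The metric `g_{KB} = (1/2) g_{1,1}` of the Siegel-Jacobi space `S^J`, whose underlying complex
manifold is `ℍ × ℂ`. -/
def metricSJ (q : ℍ × ℂ) (X Y : TangentSpace (𝓘(ℝ, ℂ).prod 𝓘(ℝ, ℂ)) q) : ℝ :=
  1 / 2 * (realCoords X ⬝ᵥ kaehlerBerndtMatrix 1 1 q *ᵥ realCoords Y)

/-- The complex structure of `ℍ × ℂ`: multiplication by `i`. -/
def complexStructureSJ (q : ℍ × ℂ) (X : TangentSpace (𝓘(ℝ, ℂ).prod 𝓘(ℝ, ℂ)) q) :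
    TangentSpace (𝓘(ℝ, ℂ).prod 𝓘(ℝ, ℂ)) q :=
  ((Complex.I * X.1, Complex.I * X.2) : ℂ × ℂ)

/-- The identification `T𝒩 ≅ S^J`, `(z₁, z₂) ↦ (τ, z) = (-i z₂, i z₁)`, where
`zₖ = θₖ + i θ'ₖ` are the global complex coordinates of `T𝒩`. -/
def identification : TN ≃ ℍ × ℂ where
  toFun u :=
    (⟨-Complex.I * ((u.1.1 1 : ℂ) + Complex.I * (u.1.2 1 : ℂ)), by
        have h : u.1.1 1 < 0 := u.2
        simpa using h⟩,
      Complex.I * ((u.1.1 0 : ℂ) + Complex.I * (u.1.2 0 : ℂ)))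
  invFun q := ⟨(![q.2.im, -q.1.im], ![-q.2.re, q.1.re]), by
    change -q.1.im < 0
    linarith [q.1.im_pos]⟩
  left_inv u := by
    apply Subtype.ext
    apply Prod.ext <;> funext i <;> fin_cases i <;> simp [UpperHalfPlane.im, UpperHalfPlane.re]
  right_inv q := by
    apply Prod.ext
    · apply UpperHalfPlane.ext
      apply Complex.ext <;> simp
    · apply Complex.ext <;> simp

/-! ## The affine symplectic group and its action -/

/-- The affine symplectic group `ASp(2, ℝ) = SL(2, ℝ) ⋉ ℝ²`, with multiplication
`(M₁, X₁) (M₂, X₂) = (M₁ M₂, X₁ M₂ + X₂)` (row vectors times matrices). -/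
@[ext] structure ASp where
  /-- the linear part `M = (a, b; c, d)` -/
  mat : SL(2, ℝ)
  /-- the translation part `X = (λ, μ)` -/
  vec : Fin 2 → ℝ

namespace ASp

instance : Mul ASp := ⟨fun g₁ g₂ => ⟨g₁.mat * g₂.mat, g₁.vec ᵥ* g₂.mat.1 + g₂.vec⟩⟩

instance : One ASp := ⟨⟨1, 0⟩⟩

instance : Inv ASp := ⟨fun g => ⟨g.mat⁻¹, -(g.vec ᵥ* (g.mat⁻¹).1)⟩⟩

theorem mat_mul (g₁ g₂ : ASp) : (g₁ * g₂).mat = g₁.mat * g₂.mat := rfl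

theorem vec_mul (g₁ g₂ : ASp) : (g₁ * g₂).vec = g₁.vec ᵥ* g₂.mat.1 + g₂.vec := rfl

theorem mat_one : (1 : ASp).mat = 1 := rfl

theorem vec_one : (1 : ASp).vec = 0 := rfl

instance : Group ASp :=
  Group.ofLeftAxioms
    (fun g₁ g₂ g₃ => by
      ext1
      · simp [mat_mul, mul_assoc]
      · simp [vec_mul, mat_mul, Matrix.add_vecMul, Matrix.vecMul_vecMul, add_assoc])
    (fun g => by
      ext1
      · simp [mat_mul, mat_one]
      · simp [vec_mul, vec_one])
    (fun g => by
      ext1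
      · exact inv_mul_cancel g.mat
      · change -(g.vec ᵥ* (g.mat⁻¹).1) ᵥ* g.mat.1 + g.vec = 0
        have h : (g.mat⁻¹).1 * g.mat.1 = 1 := congrArg Subtype.val (inv_mul_cancel g.mat)
        rw [Matrix.neg_vecMul, Matrix.vecMul_vecMul, h]
        simp)

/-- The action of `ASp(2, ℝ)` on `ℍ × ℂ`:
`(M, (λ, μ)) • (τ, z) = ((aτ + b)/(cτ + d), (z + λτ + μ)/(cτ + d))`. -/
instance : SMul ASp (ℍ × ℂ) :=
  ⟨fun g q => (g.mat • q.1,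
    (q.2 + (g.vec 0 : ℂ) * (q.1 : ℂ) + (g.vec 1 : ℂ)) /
      ((g.mat 1 0 : ℂ) * (q.1 : ℂ) + (g.mat 1 1 : ℂ)))⟩

theorem smul_def (g : ASp) (q : ℍ × ℂ) : g • q = (g.mat • q.1,
    (q.2 + (g.vec 0 : ℂ) * (q.1 : ℂ) + (g.vec 1 : ℂ)) /
      ((g.mat 1 0 : ℂ) * (q.1 : ℂ) + (g.mat 1 1 : ℂ))) := rfl

instance : MulAction ASp (ℍ × ℂ) where
  one_smul q := by
    simp [smul_def, mat_one, vec_one]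
  mul_smul g₁ g₂ q := by
    obtain ⟨M, X⟩ := g₁
    obtain ⟨N, Y⟩ := g₂
    obtain ⟨t, z⟩ := q
    apply Prod.ext
    · exact mul_smul M N t
    · have hN : ((N 1 0 : ℝ) : ℂ) * (t : ℂ) + ((N 1 1 : ℝ) : ℂ) ≠ 0 :=
        UpperHalfPlane.denom_ne_zero (N : GL (Fin 2) ℝ) t
      have hM : ((M 1 0 : ℝ) : ℂ) * ((N • t : ℍ) : ℂ) + ((M 1 1 : ℝ) : ℂ) ≠ 0 :=
        UpperHalfPlane.denom_ne_zero (M : GL (Fin 2) ℝ) (N • t)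
      have hMN : (((M * N) 1 0 : ℝ) : ℂ) * (t : ℂ) + (((M * N) 1 1 : ℝ) : ℂ) ≠ 0 :=
        UpperHalfPlane.denom_ne_zero ((M * N : SL(2, ℝ)) : GL (Fin 2) ℝ) t
      have ht : ((N • t : ℍ) : ℂ) = ((N 0 0 : ℝ) * (t : ℂ) + (N 0 1 : ℝ)) /
          ((N 1 0 : ℝ) * (t : ℂ) + (N 1 1 : ℝ)) := coe_specialLinearGroup_apply N t
      simp only [smul_def, mat_mul, vec_mul]
      rw [div_eq_div_iff hMN hM, ht]
      have a10 : (M * N) 1 0 = M 1 0 * N 0 0 + M 1 1 * N 1 0 := by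
        simp [Matrix.mul_apply, Fin.sum_univ_two]
      have a11 : (M * N) 1 1 = M 1 0 * N 0 1 + M 1 1 * N 1 1 := by
        simp [Matrix.mul_apply, Fin.sum_univ_two]
      rw [a10, a11]
      simp only [Pi.add_apply, Matrix.vecMul, dotProduct, Fin.sum_univ_two, Complex.ofReal_add,
        Complex.ofReal_mul]
      field_simp
      ring

end ASp

/-- The homomorphism from `ASp(2, ℝ)` to the permutations of `T𝒩` given by the action on
`ℍ × ℂ ≅ T𝒩`. -/
def actionTN : ASp →* Equiv.Perm TN :=
  identification.symm.permCongrHom.toMonoidHom.comp (MulAction.toPermHom ASp (ℍ × ℂ))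

end

/-! The Gaussians form an exponential family, so each score is a sufficient statistic (`x` or `x²`)
minus its mean. Hence `∂ᵢ∂ⱼ ln p` does not depend on `x`, and since scores have mean zero, all
Christoffel symbols of the exponential connection vanish in the natural parameters
(`gaussianGamma_eq_zero`). Dombrowski's `J` is then multiplication by `i` in the coordinates `zₖ`,
and the metric is two copies of the covariance matrix of `(x, x²)`. The identification with `S^J`
becomes a comparison of explicit matrices (`metricSJ_identificationL`).

On `ℍ × ℂ`, completing the square gives `2 g_{KB} = |dτ|²/v² + |η|²/v` with `η = dz - (y/v) dτ`
(`metricSJ_eq`). Under an element of `ASp(2, ℝ)` with automorphy factor `j = cτ + d`, the quantities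
`dτ`, `η`, `v` are multiplied by `j⁻²`, `j⁻¹`, `|j|⁻²`, so the metric is invariant
(`metricSJ_smulDeriv`).

Conversely, let `ψ` be a holomorphic isometry of `S^J`. By Liouville its first component depends on
`τ` only (`fst_apply_eq`). It is therefore an automorphism of `ℍ`, which by the Schwarz lemma is a
Möbius transformation (`exists_smul_eq_of_differentiableOn`). Dividing it out leaves a `ψ` over the
identity of `ℍ`, which must preserve `|η|` (`exists_smul_eq_of_fst_eq`). This forces the second
component to be `a z + f(τ)` with `|a| = 1`; the kernel of `η` then gives a formula for `f'` from
which `a = ±1` and `f(τ) = lτ + m` with real `l`, `m`. Such a map belongs to `ASp(2, ℝ)`, the sign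
being the action of `-1 ∈ SL(2, ℝ)`. -/

/-! ## Coordinates on `ℍ × ℂ` and on `T𝒩` -/

/-- The inclusion `ℍ × ℂ → ℂ × ℂ`. -/
def toCoord (q : ℍ × ℂ) : ℂ × ℂ := (↑q.1, q.2)

/-- An extension to `ℂ × ℂ` of the inverse of `toCoord`. -/
noncomputable def ofCoord (p : ℂ × ℂ) : ℍ × ℂ := (ofComplex p.1, p.2)

theorem ofCoord_toCoord (q : ℍ × ℂ) : ofCoord (toCoord q) = q := by
  simp [ofCoord, toCoord]

theorem toCoord_ofCoord {p : ℂ × ℂ} (hp : 0 < p.1.im) : toCoord (ofCoord p) = p := by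
  simp [ofCoord, toCoord, ofComplex_apply_of_im_pos hp]

theorem continuous_toCoord : Continuous toCoord :=
  (UpperHalfPlane.continuous_coe.comp continuous_fst).prodMk continuous_snd

theorem toCoord_comp_ofCoord_eventuallyEq {p : ℂ × ℂ} (hp : 0 < p.1.im) :
    toCoord ∘ ofCoord =ᶠ[nhds p] id := by
  have ho : IsOpen {p : ℂ × ℂ | 0 < p.1.im} :=
    isOpen_lt continuous_const (Complex.continuous_im.comp continuous_fst)
  filter_upwards [ho.mem_nhds hp] with x hx using toCoord_ofCoord hx

theorem continuousAt_ofCoord {p : ℂ × ℂ} (hp : 0 < p.1.im) : ContinuousAt ofCoord p := by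
  have h : ContinuousAt ofComplex p.1 := (contMDiffAt_ofComplex (n := 0) hp).continuousAt
  exact (ContinuousAt.comp (f := Prod.fst) h continuousAt_fst).prodMk continuousAt_snd

theorem contMDiff_toCoord : ContMDiff (𝓘(ℝ, ℂ).prod 𝓘(ℝ, ℂ)) 𝓘(ℝ, ℂ × ℂ) ∞ toCoord := by
  intro q
  rw [_root_.contMDiffAt_iff]
  refine ⟨continuous_toCoord.continuousAt, ?_⟩
  have := (toCoord_comp_ofCoord_eventuallyEq (p := toCoord q) q.1.im_pos)
  exact (contDiffAt_id.congr_of_eventuallyEq this).contDiffWithinAt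

theorem contMDiffAt_ofCoord {p : ℂ × ℂ} (hp : 0 < p.1.im) :
    ContMDiffAt 𝓘(ℝ, ℂ × ℂ) (𝓘(ℝ, ℂ).prod 𝓘(ℝ, ℂ)) ∞ ofCoord p := by
  rw [_root_.contMDiffAt_iff]
  refine ⟨continuousAt_ofCoord hp, ?_⟩
  exact (contDiffAt_id.congr_of_eventuallyEq
    (toCoord_comp_ofCoord_eventuallyEq hp)).contDiffWithinAt

/-- The chart of `ℍ` is the inclusion into `ℂ`, so in charts `toCoord` reads `toCoord ∘ ofCoord`,
the identity near the point. Tangent vectors of `ℍ × ℂ` are thus literally vectors of `ℂ × ℂ`. -/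
theorem hasMFDerivAt_toCoord (q : ℍ × ℂ) :
    HasMFDerivAt (𝓘(ℝ, ℂ).prod 𝓘(ℝ, ℂ)) 𝓘(ℝ, ℂ × ℂ) toCoord q
      (ContinuousLinearMap.id ℝ (ℂ × ℂ)) := by
  refine ⟨continuous_toCoord.continuousAt, ?_⟩
  have := (toCoord_comp_ofCoord_eventuallyEq (p := toCoord q) q.1.im_pos)
  exact ((hasFDerivAt_id _).congr_of_eventuallyEq this).hasFDerivWithinAt

theorem hasMFDerivAt_ofCoord {p : ℂ × ℂ} (hp : 0 < p.1.im) :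
    HasMFDerivAt 𝓘(ℝ, ℂ × ℂ) (𝓘(ℝ, ℂ).prod 𝓘(ℝ, ℂ)) ofCoord p
      (ContinuousLinearMap.id ℝ (ℂ × ℂ)) := by
  refine ⟨continuousAt_ofCoord hp, ?_⟩
  exact ((hasFDerivAt_id _).congr_of_eventuallyEq
    (toCoord_comp_ofCoord_eventuallyEq hp)).hasFDerivWithinAt

theorem hasMFDerivAt_val {E : Type*} [NormedAddCommGroup E] [NormedSpace ℝ E]
    (U : TopologicalSpace.Opens E) (u : U) :
    HasMFDerivAt 𝓘(ℝ, E) 𝓘(ℝ, E) (Subtype.val : U → E) u (ContinuousLinearMap.id ℝ E) := by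
  refine ⟨continuous_subtype_val.continuousAt, ?_⟩
  have h := U.chartAt_subtype_val_symm_eventuallyEq (H := E) (x := u)
  exact ((hasFDerivAt_id _).congr_of_eventuallyEq h.symm).hasFDerivWithinAt

/-- A map into `ℍ × ℂ` is smooth as soon as its coordinates are. -/
theorem contMDiff_of_toCoord {E H M : Type*} [NormedAddCommGroup E] [NormedSpace ℝ E]
    [TopologicalSpace H] {I : ModelWithCorners ℝ E H} [TopologicalSpace M] [ChartedSpace H M]
    {f : M → ℍ × ℂ} (hf : ContMDiff I 𝓘(ℝ, ℂ × ℂ) ∞ (toCoord ∘ f)) :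
    ContMDiff I (𝓘(ℝ, ℂ).prod 𝓘(ℝ, ℂ)) ∞ f := by
  intro x
  have h := (contMDiffAt_ofCoord (p := (toCoord ∘ f) x) (f x).1.im_pos).comp x (hf x)
  have e : ofCoord ∘ toCoord ∘ f = f := funext fun y => ofCoord_toCoord _
  rwa [e] at h

/-- The derivative of a map into `ℍ × ℂ`, read off from its coordinates. -/
theorem hasMFDerivAt_of_toCoord {E H M : Type*} [NormedAddCommGroup E] [NormedSpace ℝ E]
    [TopologicalSpace H] {I : ModelWithCorners ℝ E H} [TopologicalSpace M] [ChartedSpace H M]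
    {f : M → ℍ × ℂ} {x : M} {L : E →L[ℝ] ℂ × ℂ}
    (hf : HasMFDerivAt I 𝓘(ℝ, ℂ × ℂ) (toCoord ∘ f) x L) :
    HasMFDerivAt I (𝓘(ℝ, ℂ).prod 𝓘(ℝ, ℂ)) f x L := by
  have h := HasMFDerivAt.comp x
    (hasMFDerivAt_ofCoord (p := (toCoord ∘ f) x) (f x).1.im_pos) hf
  have e : ofCoord ∘ toCoord ∘ f = f := funext fun y => ofCoord_toCoord _
  rw [e] at h
  exact h

/-- The coordinate expression of the identification `T𝒩 ≅ ℍ × ℂ`. -/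
noncomputable def identificationL : ((Fin 2 → ℝ) × (Fin 2 → ℝ)) →L[ℝ] ℂ × ℂ :=
  LinearMap.toContinuousLinearMap
    { toFun := fun A => (⟨A.2 1, -A.1 1⟩, ⟨-A.2 0, A.1 0⟩)
      map_add' := fun A B => by
        apply Prod.ext <;> apply Complex.ext <;> simp <;> ring
      map_smul' := fun c A => by
        apply Prod.ext <;> apply Complex.ext <;> simp }

theorem identificationL_apply (A : (Fin 2 → ℝ) × (Fin 2 → ℝ)) :
    identificationL A = (⟨A.2 1, -A.1 1⟩, ⟨-A.2 0, A.1 0⟩) := rfl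

theorem toCoord_identification (u : TN) : toCoord (identification u) = identificationL u.1 := by
  rw [identificationL_apply]
  apply Prod.ext <;> apply Complex.ext <;> simp [toCoord, identification]

/-- The coordinate expression of the inverse of the identification `T𝒩 ≅ ℍ × ℂ`. -/
noncomputable def identificationSymmL : ℂ × ℂ →L[ℝ] ((Fin 2 → ℝ) × (Fin 2 → ℝ)) :=
  LinearMap.toContinuousLinearMap
    { toFun := fun p => (![p.2.im, -p.1.im], ![-p.2.re, p.1.re])
      map_add' := fun A B => by
        apply Prod.ext <;> funext i <;> fin_cases i <;> simp <;> ring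
      map_smul' := fun c A => by
        apply Prod.ext <;> funext i <;> fin_cases i <;> simp }

theorem contMDiff_identification :
    ContMDiff 𝓘(ℝ, (Fin 2 → ℝ) × (Fin 2 → ℝ)) (𝓘(ℝ, ℂ).prod 𝓘(ℝ, ℂ)) ∞ identification := by
  apply contMDiff_of_toCoord
  have e : toCoord ∘ identification = identificationL ∘ Subtype.val :=
    funext toCoord_identification
  rw [e]
  exact identificationL.contDiff.contMDiff.comp contMDiff_subtype_val

theorem hasMFDerivAt_identification (u : TN) :
    HasMFDerivAt 𝓘(ℝ, (Fin 2 → ℝ) × (Fin 2 → ℝ)) (𝓘(ℝ, ℂ).prod 𝓘(ℝ, ℂ)) identification u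
      identificationL := by
  apply hasMFDerivAt_of_toCoord
  have e : toCoord ∘ identification = identificationL ∘ Subtype.val :=
    funext toCoord_identification
  rw [e]
  exact HasMFDerivAt.comp u identificationL.hasFDerivAt.hasMFDerivAt (hasMFDerivAt_val _ u)

theorem contMDiff_identification_symm :
    ContMDiff (𝓘(ℝ, ℂ).prod 𝓘(ℝ, ℂ)) 𝓘(ℝ, (Fin 2 → ℝ) × (Fin 2 → ℝ)) ∞ identification.symm := by
  rw [← ContMDiff.subtypeVal_comp_iff]
  exact identificationSymmL.contDiff.contMDiff.comp contMDiff_toCoord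

/-- A smooth map between copies of `ℍ × ℂ` is differentiable in coordinates, with the same
derivative. -/
theorem hasFDerivAt_coord {ψ : ℍ × ℂ → ℍ × ℂ} {q : ℍ × ℂ} {L : ℂ × ℂ →L[ℝ] ℂ × ℂ}
    (h : HasMFDerivAt (𝓘(ℝ, ℂ).prod 𝓘(ℝ, ℂ)) (𝓘(ℝ, ℂ).prod 𝓘(ℝ, ℂ)) ψ q L) :
    HasFDerivAt (toCoord ∘ ψ ∘ ofCoord) L (toCoord q) := by
  have hs := hasMFDerivAt_ofCoord (p := toCoord q) q.1.im_pos
  have h' : HasMFDerivAt (𝓘(ℝ, ℂ).prod 𝓘(ℝ, ℂ)) (𝓘(ℝ, ℂ).prod 𝓘(ℝ, ℂ)) ψ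
      (ofCoord (toCoord q)) L := by
    rw [ofCoord_toCoord]; exact h
  have h2 := HasMFDerivAt.comp _ (hasMFDerivAt_toCoord _) (HasMFDerivAt.comp _ h' hs)
  exact h2.hasFDerivAt

/-! ## The Fisher metric and the exponential connection of the Gaussian family -/

theorem moments_gaussianReal (v : NNReal) :
    ∫ y, y ∂ProbabilityTheory.gaussianReal 0 v = 0 ∧
    ∫ y, y ^ 2 ∂ProbabilityTheory.gaussianReal 0 v = v ∧
    ∫ y, y ^ 3 ∂ProbabilityTheory.gaussianReal 0 v = 0 ∧
    ∫ y, y ^ 4 ∂ProbabilityTheory.gaussianReal 0 v = 3 * (v : ℝ) ^ 2 := by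
  -- The moments are the derivatives at `0` of the moment generating function `exp (v t² / 2)`.
  have hm : ∀ n, ∫ y, y ^ n ∂ProbabilityTheory.gaussianReal 0 v =
      iteratedDeriv n (fun t : ℝ => Real.exp (v * t ^ 2 / 2)) 0 := by
    intro n
    have h := ProbabilityTheory.iteratedDeriv_mgf_zero (X := fun x : ℝ => x)
      (μ := ProbabilityTheory.gaussianReal 0 v) (by simp) n
    rw [ProbabilityTheory.mgf_fun_id_gaussianReal] at h
    simpa using h.symm
  have hE : ∀ t : ℝ, HasDerivAt (fun t : ℝ => Real.exp (v * t ^ 2 / 2))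
      (Real.exp (v * t ^ 2 / 2) * (v * t)) t := by
    intro t
    have h : HasDerivAt (fun t : ℝ => (v : ℝ) * t ^ 2 / 2) (v * t) t := by
      have := ((hasDerivAt_pow 2 t).const_mul (v : ℝ)).div_const 2
      refine this.congr_deriv ?_
      push_cast
      ring
    exact h.exp
  have hP : ∀ (p : ℝ → ℝ) (p' t : ℝ), HasDerivAt p p' t →
      deriv (fun t : ℝ => p t * Real.exp (v * t ^ 2 / 2)) t =
        (p' + p t * (v * t)) * Real.exp (v * t ^ 2 / 2) := by
    intro p p' t hp
    rw [(hp.fun_mul (hE t)).deriv]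
    ring
  have h1 : iteratedDeriv 1 (fun t : ℝ => Real.exp (v * t ^ 2 / 2)) =
      fun t => (v * t) * Real.exp (v * t ^ 2 / 2) := by
    rw [iteratedDeriv_one]
    funext t
    rw [(hE t).deriv, mul_comm]
  have h2 : iteratedDeriv 2 (fun t : ℝ => Real.exp (v * t ^ 2 / 2)) =
      fun t => (v + v ^ 2 * t ^ 2) * Real.exp (v * t ^ 2 / 2) := by
    rw [iteratedDeriv_succ, h1]
    funext t
    rw [hP _ v t (by simpa using (hasDerivAt_id t).const_mul (v : ℝ))]
    ring
  have h3 : iteratedDeriv 3 (fun t : ℝ => Real.exp (v * t ^ 2 / 2)) =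
      fun t => (3 * v ^ 2 * t + v ^ 3 * t ^ 3) * Real.exp (v * t ^ 2 / 2) := by
    rw [iteratedDeriv_succ, h2]
    funext t
    rw [hP _ (v ^ 2 * (2 * t)) t
      (by simpa using ((hasDerivAt_pow 2 t).const_mul ((v : ℝ) ^ 2)).const_add (v : ℝ))]
    ring
  have h4 : iteratedDeriv 4 (fun t : ℝ => Real.exp (v * t ^ 2 / 2)) =
      fun t => (3 * v ^ 2 + 6 * v ^ 3 * t ^ 2 + v ^ 4 * t ^ 4) * Real.exp (v * t ^ 2 / 2) := by
    rw [iteratedDeriv_succ, h3]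
    funext t
    have h := ((hasDerivAt_id t).const_mul (3 * (v : ℝ) ^ 2)).fun_add
      ((hasDerivAt_pow 3 t).const_mul ((v : ℝ) ^ 3))
    rw [hP _ (3 * v ^ 2 + v ^ 3 * (3 * t ^ 2)) t (by simpa using h)]
    ring
  refine ⟨?_, ?_, ?_, ?_⟩
  · simp
  · simpa [h2] using hm 2
  · simpa [h3] using hm 3
  · simpa [h4] using hm 4

theorem integral_quartic_gaussianReal (v : NNReal) (a₀ a₁ a₂ a₃ a₄ : ℝ) :
    ∫ y, (a₀ + a₁ * y + a₂ * y ^ 2 + a₃ * y ^ 3 + a₄ * y ^ 4)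
      ∂ProbabilityTheory.gaussianReal 0 v = a₀ + a₂ * v + 3 * a₄ * (v : ℝ) ^ 2 := by
  have hi : ∀ n : ℕ, Integrable (fun y : ℝ => y ^ n) (ProbabilityTheory.gaussianReal 0 v) :=
    fun n => ProbabilityTheory.integrable_pow_of_mem_interior_integrableExpSet
      (X := fun y : ℝ => y) (by simp) n
  obtain ⟨m1, m2, m3, m4⟩ := moments_gaussianReal v
  have i1 : Integrable (fun y : ℝ => y) (ProbabilityTheory.gaussianReal 0 v) := by
    simpa using hi 1
  rw [integral_add, integral_add, integral_add, integral_add, integral_const_mul,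
    integral_const_mul, integral_const_mul, integral_const_mul, m1, m2, m3, m4]
  · simp
    ring
  · exact integrable_const _
  · exact i1.const_mul _
  · exact (integrable_const _).add (i1.const_mul _)
  · exact (hi 2).const_mul _
  · exact ((integrable_const _).add (i1.const_mul _)).add ((hi 2).const_mul _)
  · exact (hi 3).const_mul _
  · exact (((integrable_const _).add (i1.const_mul _)).add ((hi 2).const_mul _)).add
      ((hi 3).const_mul _)
  · exact (hi 4).const_mul _

theorem gaussianDensity_eq_gaussianPDFReal {θ : Fin 2 → ℝ} (h : θ 1 < 0) :
    gaussianDensity θ =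
      ProbabilityTheory.gaussianPDFReal (-θ 0 / (2 * θ 1)) (Real.toNNReal (-1 / (2 * θ 1))) := by
  have h0 : θ 1 ≠ 0 := h.ne
  have hv : 0 < -1 / (2 * θ 1) := div_pos_of_neg_of_neg (by norm_num) (by linarith)
  funext x
  have hpi : 0 < -Real.pi / θ 1 := div_pos_of_neg_of_neg (by linarith [Real.pi_pos]) h
  rw [ProbabilityTheory.gaussianPDFReal, Real.coe_toNNReal _ hv.le, gaussianDensity]
  have e : 2 * Real.pi * (-1 / (2 * θ 1)) = -Real.pi / θ 1 := by field_simp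
  rw [e, Real.sqrt_eq_rpow, Real.rpow_def_of_pos hpi, ← Real.exp_neg, ← Real.exp_add]
  congr 1
  field_simp
  ring

/-- The expectation of a polynomial of degree at most four in `x - m` under the Gaussian density
with natural parameter `θ`, where `m` is its mean. -/
theorem integral_quartic_gaussianDensity {θ : Fin 2 → ℝ} (h : θ 1 < 0) (F : ℝ → ℝ)
    (a₀ a₁ a₂ a₃ a₄ : ℝ)
    (hF : ∀ y, F (y + -θ 0 / (2 * θ 1)) = a₀ + a₁ * y + a₂ * y ^ 2 + a₃ * y ^ 3 + a₄ * y ^ 4) :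
    ∫ x, F x * gaussianDensity θ x =
      a₀ + a₂ * (-1 / (2 * θ 1)) + 3 * a₄ * (-1 / (2 * θ 1)) ^ 2 := by
  have hv : 0 < -1 / (2 * θ 1) := div_pos_of_neg_of_neg (by norm_num) (by linarith)
  have hm : ProbabilityTheory.gaussianReal (-θ 0 / (2 * θ 1)) (Real.toNNReal (-1 / (2 * θ 1))) =
      (ProbabilityTheory.gaussianReal 0 (Real.toNNReal (-1 / (2 * θ 1)))).map
        (· + -θ 0 / (2 * θ 1)) := by
    rw [ProbabilityTheory.gaussianReal_map_add_const, zero_add]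
  have h1 := ProbabilityTheory.integral_gaussianReal_eq_integral_smul
    (μ := -θ 0 / (2 * θ 1)) (f := F) (Real.toNNReal_pos.2 hv).ne'
  rw [gaussianDensity_eq_gaussianPDFReal h]
  simp only [smul_eq_mul] at h1
  simp only [mul_comm (F _)]
  rw [← h1, hm, MeasurableEmbedding.integral_map (measurableEmbedding_addRight _)]
  simp only [hF]
  rw [integral_quartic_gaussianReal, Real.coe_toNNReal _ hv.le]

/-- Reduces a partial derivative to one-variable calculus. Differentiability is required separately
because `fderiv` takes the default value `0` without it. -/
theorem partialDeriv_eq {n : ℕ} {i : Fin n} {F : (Fin n → ℝ) → ℝ} {θ : Fin n → ℝ} {d : ℝ}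
    (hF : DifferentiableAt ℝ F θ)
    (h : HasDerivAt (fun s : ℝ => F (θ + s • Pi.single i 1)) d 0) : partialDeriv i F θ = d := by
  rw [partialDeriv, ← hF.lineDeriv_eq_fderiv]
  exact h.deriv

theorem differentiableAt_log_gaussianDensity {θ : Fin 2 → ℝ} (h : θ 1 ≠ 0) (x : ℝ) :
    DifferentiableAt ℝ (fun t => Real.log (gaussianDensity t x)) θ := by
  simp only [gaussianDensity, Real.log_exp]
  have h' : -Real.pi / θ 1 ≠ 0 := div_ne_zero (neg_ne_zero.2 Real.pi_ne_zero) h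
  have h4 : 4 * θ 1 ≠ 0 := mul_ne_zero four_ne_zero h
  fun_prop (disch := assumption)

/-- The mean is `-θ₁/(2θ₂)` and the variance `-1/(2θ₂)`, so this score is `x - E[x]`; likewise the
next one is `x² - E[x²]`. -/
theorem score_gaussianDensity_zero {θ : Fin 2 → ℝ} (h : θ 1 ≠ 0) (x : ℝ) :
    score gaussianDensity 0 θ x = x - -θ 0 / (2 * θ 1) := by
  refine partialDeriv_eq (differentiableAt_log_gaussianDensity h x) ?_
  simp only [gaussianDensity, Real.log_exp, Pi.add_apply, Pi.smul_apply, smul_eq_mul,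
    Pi.single_eq_same, Pi.single_eq_of_ne (one_ne_zero : (1 : Fin 2) ≠ 0), mul_one, mul_zero,
    add_zero]
  have h0 : HasDerivAt (fun s : ℝ => θ 0 + s) 1 0 := (hasDerivAt_id 0).const_add _
  have := ((h0.mul_const x).add_const (θ 1 * x ^ 2)).fun_sub
    (((h0.fun_pow 2).neg.div_const (4 * θ 1)).add_const (1 / 2 * Real.log (-Real.pi / θ 1)))
  refine this.congr_deriv ?_
  simp
  field_simp
  ring

theorem score_gaussianDensity_one {θ : Fin 2 → ℝ} (h : θ 1 ≠ 0) (x : ℝ) :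
    score gaussianDensity 1 θ x = x ^ 2 - ((-θ 0 / (2 * θ 1)) ^ 2 + -1 / (2 * θ 1)) := by
  refine partialDeriv_eq (differentiableAt_log_gaussianDensity h x) ?_
  simp only [gaussianDensity, Real.log_exp, Pi.add_apply, Pi.smul_apply, smul_eq_mul,
    Pi.single_eq_same, Pi.single_eq_of_ne (zero_ne_one : (0 : Fin 2) ≠ 1), mul_one, mul_zero,
    add_zero]
  have h0 : HasDerivAt (fun s : ℝ => θ 1 + s) 1 0 := (hasDerivAt_id 0).const_add _
  have h' : -Real.pi / (θ 1 + 0) ≠ 0 := by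
    simpa using div_ne_zero (neg_ne_zero.2 Real.pi_ne_zero) h
  have hn : θ 1 + 0 ≠ 0 := by simpa using h
  have hl := (((hasDerivAt_const (0 : ℝ) (-Real.pi)).fun_div h0 hn).log h').const_mul (1 / 2)
  have hq := (hasDerivAt_const (0 : ℝ) (-θ 0 ^ 2)).fun_div (h0.const_mul 4)
    (mul_ne_zero four_ne_zero hn)
  have := ((h0.mul_const (x ^ 2)).const_add (θ 0 * x)).fun_sub (hq.fun_add hl)
  refine this.congr_deriv ?_
  simp
  field_simp
  ring

theorem fisherMatrix_gaussianDensity {θ : Fin 2 → ℝ} (h : θ 1 < 0) :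
    fisherMatrix volume gaussianDensity θ =
      !![-1 / (2 * θ 1), θ 0 / (2 * θ 1 ^ 2);
        θ 0 / (2 * θ 1 ^ 2), 1 / (2 * θ 1 ^ 2) - θ 0 ^ 2 / (2 * θ 1 ^ 3)] := by
  have h0 := h.ne
  ext i j
  fin_cases i <;> fin_cases j <;>
    simp only [fisherMatrix, Matrix.of_apply, Fin.zero_eta, Fin.mk_one, Fin.isValue,
      score_gaussianDensity_zero h0, score_gaussianDensity_one h0]
  · rw [integral_quartic_gaussianDensity h _ 0 0 1 0 0 (fun y => by ring)]
    simp
  -- With `y = x - m` and variance `s`, the second score is `y² + 2m y - s`, where `2m = -θ₁/θ₂` and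
  -- `-s = 1/(2θ₂)`; the coefficients below are those of the products of the scores.
  · rw [integral_quartic_gaussianDensity h _ 0 (1 / (2 * θ 1)) (-θ 0 / θ 1) 1 0
      (fun y => by field_simp; ring)]
    simp
    field_simp
  · rw [integral_quartic_gaussianDensity h _ 0 (1 / (2 * θ 1)) (-θ 0 / θ 1) 1 0
      (fun y => by field_simp; ring)]
    simp
    field_simp
  · rw [integral_quartic_gaussianDensity h _ ((1 / (2 * θ 1)) ^ 2) (2 * (1 / (2 * θ 1)) *
      (-θ 0 / θ 1)) (2 * (1 / (2 * θ 1)) + (-θ 0 / θ 1) ^ 2) (2 * (-θ 0 / θ 1)) 1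
      (fun y => by field_simp; ring)]
    simp
    field_simp
    ring

theorem integral_score_gaussianDensity {θ : Fin 2 → ℝ} (h : θ 1 < 0) (c : ℝ) (k : Fin 2) :
    ∫ x, c * score gaussianDensity k θ x * gaussianDensity θ x = 0 := by
  have h0 := h.ne
  fin_cases k <;>
    simp only [Fin.zero_eta, Fin.mk_one, Fin.isValue,
      score_gaussianDensity_zero h0, score_gaussianDensity_one h0]
  · rw [integral_quartic_gaussianDensity h _ 0 c 0 0 0 (fun y => by ring)]
    simp
  · rw [integral_quartic_gaussianDensity h _ (c * (1 / (2 * θ 1))) (c * (-θ 0 / θ 1)) c 0 0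
      (fun y => by field_simp; ring)]
    field_simp
    ring

/-- In a score, `x` and the parameter separate as `a x - g t`, so the derivative in `t` no longer
sees `x`. -/
theorem partialDeriv_score_gaussianDensity {θ : Fin 2 → ℝ} (h : θ 1 < 0) (i j : Fin 2) :
    ∃ c : ℝ, ∀ x, partialDeriv i (fun t => score gaussianDensity j t x) θ = c := by
  have he : ∀ᶠ t in nhds θ, t 1 < 0 :=
    (isOpen_lt (continuous_apply 1) continuous_const).mem_nhds h
  obtain ⟨a, g, hg⟩ : ∃ (a : ℝ → ℝ) (g : (Fin 2 → ℝ) → ℝ), ∀ t : Fin 2 → ℝ, t 1 < 0 →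
      ∀ x, score gaussianDensity j t x = a x - g t := by
    fin_cases j
    · exact ⟨_, fun t => _, fun t ht x => score_gaussianDensity_zero ht.ne x⟩
    · exact ⟨_, fun t => _, fun t ht x => score_gaussianDensity_one ht.ne x⟩
  refine ⟨partialDeriv i (fun t => -g t) θ, fun x => ?_⟩
  have e : (fun t => score gaussianDensity j t x) =ᶠ[nhds θ] fun t => a x - g t := by
    filter_upwards [he] with t ht using hg t ht x
  rw [partialDeriv, partialDeriv, e.fderiv_eq, fderiv_const_sub, fderiv_fun_neg]

/-- Each lower symbol is a constant times the expectation of a score, hence zero; the inverse Fisher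
matrix plays no role. -/
theorem gaussianGamma_eq_zero {θ : Fin 2 → ℝ} (h : θ 1 < 0) (i j k : Fin 2) :
    gaussianGamma θ i j k = 0 := by
  unfold gaussianGamma exponentialChristoffel
  refine Finset.sum_eq_zero fun l _ => ?_
  obtain ⟨c, hc⟩ := partialDeriv_score_gaussianDensity h i j
  simp only [exponentialLower, hc, integral_score_gaussianDensity h, mul_zero]

/-! ### The Kähler structure of `T𝒩` in flat coordinates -/

theorem connectionSplit_gaussianGamma {u : (Fin 2 → ℝ) × (Fin 2 → ℝ)} (h : u.1 1 < 0)
    (A : (Fin 2 → ℝ) × (Fin 2 → ℝ)) : connectionSplit gaussianGamma u A = A := by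
  have : christoffelMap gaussianGamma u.1 u.2 A.1 = 0 := by
    funext k
    simp [christoffelMap, gaussianGamma_eq_zero h]
  simp [connectionSplit, this]

theorem connectionJoin_gaussianGamma {u : (Fin 2 → ℝ) × (Fin 2 → ℝ)} (h : u.1 1 < 0)
    (A : (Fin 2 → ℝ) × (Fin 2 → ℝ)) : connectionJoin gaussianGamma u A = A := by
  have : christoffelMap gaussianGamma u.1 u.2 A.1 = 0 := by
    funext k
    simp [christoffelMap, gaussianGamma_eq_zero h]
  simp [connectionJoin, this]

/-- With `v = -θ₂` and `y = θ₁` the Kähler-Berndt coefficients, including the factor `1/2`, are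
those of the Fisher matrix. -/
theorem metricSJ_identificationL (u : TN) (A B : (Fin 2 → ℝ) × (Fin 2 → ℝ)) :
    metricSJ (identification u) (identificationL A) (identificationL B) = metricTN u A B := by
  have h : u.1.1 1 < 0 := u.2
  have h0 := h.ne
  have e1 : (identification u).1.im = -u.1.1 1 := by
    have := congrArg (fun p : ℂ × ℂ => p.1.im) (toCoord_identification u)
    exact this
  have e2 : (identification u).2.im = u.1.1 0 := by
    simp [identification]
  unfold metricSJ metricTN dombrowskiMetric
  rw [connectionSplit_gaussianGamma h,
    connectionSplit_gaussianGamma h, fisherMatrix_gaussianDensity h]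
  simp only [kaehlerBerndtMatrix, e1, e2, realCoords, identificationL_apply]
  simp [Matrix.mulVec, dotProduct, Fin.sum_univ_succ]
  field_simp
  ring

theorem complexStructureSJ_identificationL (u : TN) (A : (Fin 2 → ℝ) × (Fin 2 → ℝ)) :
    identificationL (complexStructureTN u A) =
      complexStructureSJ (identification u) (identificationL A) := by
  have h : u.1.1 1 < 0 := u.2
  unfold complexStructureTN dombrowskiJ
  rw [connectionSplit_gaussianGamma h,
    connectionJoin_gaussianGamma h]
  simp only [complexStructureSJ, identificationL_apply]
  apply Prod.ext <;> apply Complex.ext <;> simp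

/-! ## Holomorphic isometries between almost Hermitian manifolds -/

section IsHolomorphicIsometry

variable {E H M E' H' M' E'' H'' M'' : Type*} [NormedAddCommGroup E] [NormedSpace ℝ E]
  [TopologicalSpace H] [TopologicalSpace M] [ChartedSpace H M] [NormedAddCommGroup E']
  [NormedSpace ℝ E'] [TopologicalSpace H'] [TopologicalSpace M'] [ChartedSpace H' M']
  [NormedAddCommGroup E''] [NormedSpace ℝ E''] [TopologicalSpace H''] [TopologicalSpace M'']
  [ChartedSpace H'' M''] {I : ModelWithCorners ℝ E H} {I' : ModelWithCorners ℝ E' H'}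
  {I'' : ModelWithCorners ℝ E'' H''}
  {g : ∀ p : M, TangentSpace I p → TangentSpace I p → ℝ}
  {J : ∀ p : M, TangentSpace I p → TangentSpace I p}
  {g' : ∀ p : M', TangentSpace I' p → TangentSpace I' p → ℝ}
  {J' : ∀ p : M', TangentSpace I' p → TangentSpace I' p}
  {g'' : ∀ p : M'', TangentSpace I'' p → TangentSpace I'' p → ℝ}
  {J'' : ∀ p : M'', TangentSpace I'' p → TangentSpace I'' p}

/-- A smooth map that pulls back the metric `g'` to `g` and intertwines the almost complex
structures `J` and `J'`. -/
def IsHolomorphicIsometry (I : ModelWithCorners ℝ E H) (I' : ModelWithCorners ℝ E' H')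
    (g : ∀ p : M, TangentSpace I p → TangentSpace I p → ℝ)
    (J : ∀ p : M, TangentSpace I p → TangentSpace I p)
    (g' : ∀ p : M', TangentSpace I' p → TangentSpace I' p → ℝ)
    (J' : ∀ p : M', TangentSpace I' p → TangentSpace I' p) (f : M → M') : Prop :=
  ContMDiff I I' ∞ f ∧
    (∀ (p : M) (X Y : TangentSpace I p),
      g' (f p) (mfderiv I I' f p X) (mfderiv I I' f p Y) = g p X Y) ∧
    ∀ (p : M) (X : TangentSpace I p), mfderiv I I' f p (J p X) = J' (f p) (mfderiv I I' f p X)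

theorem mem_holomorphicIsometryGroup {φ : Equiv.Perm M} :
    φ ∈ holomorphicIsometryGroup I g J ↔
      IsHolomorphicIsometry I I g J g J φ ∧ ContMDiff I I ∞ φ.symm :=
  ⟨fun h => ⟨⟨h.1, h.2.2⟩, h.2.1⟩, fun h => ⟨h.1.1, h.2, h.1.2⟩⟩

theorem IsHolomorphicIsometry.comp {f' : M' → M''} {f : M → M'}
    (h' : IsHolomorphicIsometry I' I'' g' J' g'' J'' f')
    (h : IsHolomorphicIsometry I I' g J g' J' f) :
    IsHolomorphicIsometry I I'' g J g'' J'' (f' ∘ f) := by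
  obtain ⟨h1, h3, h4⟩ := h'
  obtain ⟨k1, k3, k4⟩ := h
  have hc : ∀ p, mfderiv I I'' (f' ∘ f) p = (mfderiv I' I'' f' (f p)).comp (mfderiv I I' f p) :=
    fun p => mfderiv_comp p (h1.mdifferentiable (by simp) _) (k1.mdifferentiable (by simp) _)
  refine ⟨h1.comp k1, fun p X Y => ?_, fun p X => ?_⟩
  · rw [hc]
    exact (h3 (f p) _ _).trans (k3 p X Y)
  · rw [hc]
    exact (congrArg (mfderiv I' I'' f' (f p)) (k4 p X)).trans (h4 (f p) _)

theorem IsHolomorphicIsometry.symm {φ : M ≃ M'} (h : IsHolomorphicIsometry I I' g J g' J' φ)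
    (h2 : ContMDiff I' I ∞ φ.symm) : IsHolomorphicIsometry I' I g' J' g J φ.symm := by
  obtain ⟨h1, h3, h4⟩ := h
  have hc : ∀ p (X : TangentSpace I' p),
      mfderiv I I' φ (φ.symm p) (mfderiv I' I φ.symm p X) = X := by
    intro p X
    have h := mfderiv_comp p (h1.mdifferentiable (by simp) (φ.symm p))
      (h2.mdifferentiable (by simp) p)
    have hid : (φ ∘ φ.symm : M' → M') = id := by ext; simp
    rw [hid, mfderiv_id] at h
    exact (congrArg (fun L => L X) h).symm
  have hc' : ∀ p (X : TangentSpace I p),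
      mfderiv I' I φ.symm (φ p) (mfderiv I I' φ p X) = X := by
    intro p X
    have h := mfderiv_comp p (h2.mdifferentiable (by simp) (φ p))
      (h1.mdifferentiable (by simp) p)
    have hid : (φ.symm ∘ φ : M → M) = id := by ext; simp
    rw [hid, mfderiv_id] at h
    exact (congrArg (fun L => L X) h).symm
  -- All tangent spaces are the model space by definition, so vectors typed in `E'` can be moved
  -- between the equal base points `φ (φ.symm p)` and `p`.
  have hg : ∀ (p q : M') (X Y : E'), q = p → g' q X Y = g' p X Y := by
    rintro p _ X Y rfl; rfl
  have hJ : ∀ (p q : M') (X : E'), q = p → (J' q X : E') = J' p X := by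
    rintro p _ X rfl; rfl
  have hd : ∀ (p q : M') (X : E'), q = p →
      (mfderiv I' I φ.symm q X : E) = mfderiv I' I φ.symm p X := by
    rintro p _ X rfl; rfl
  refine ⟨h2, fun p X Y => ?_, fun p X => ?_⟩
  · have h := h3 (φ.symm p) (mfderiv I' I φ.symm p X) (mfderiv I' I φ.symm p Y)
    rw [hc, hc] at h
    exact h.symm.trans (hg p _ X Y (φ.apply_symm_apply p))
  · have h := h4 (φ.symm p) (mfderiv I' I φ.symm p X)
    rw [hc] at h
    have h' := hc' _ (J (φ.symm p) (mfderiv I' I φ.symm p X))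
    have e1 := hd p _ (mfderiv I I' φ (φ.symm p)
      (J (φ.symm p) (mfderiv I' I φ.symm p X))) (φ.apply_symm_apply p)
    have e2 : (mfderiv I I' φ (φ.symm p) (J (φ.symm p) (mfderiv I' I φ.symm p X)) : E') =
        J' p X := Eq.trans h (hJ p _ X (φ.apply_symm_apply p))
    exact (congrArg (fun Y : E' => (mfderiv I' I φ.symm p Y : E)) e2).symm.trans
      (e1.symm.trans h')

/-- Conjugation by a holomorphic isometry carries holomorphic isometries to holomorphic
isometries. -/
theorem permCongr_mem_holomorphicIsometryGroup {f : M ≃ M'}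
    (hf : IsHolomorphicIsometry I I' g J g' J' f) (hf' : ContMDiff I' I ∞ f.symm)
    {φ : Equiv.Perm M} (hφ : φ ∈ holomorphicIsometryGroup I g J) :
    f.permCongr φ ∈ holomorphicIsometryGroup I' g' J' := by
  rw [mem_holomorphicIsometryGroup] at hφ ⊢
  exact ⟨hf.comp (hφ.1.comp (hf.symm hf')), hf.1.comp (hφ.2.comp hf')⟩

end IsHolomorphicIsometry

theorem isHolomorphicIsometry_identification :
    IsHolomorphicIsometry 𝓘(ℝ, (Fin 2 → ℝ) × (Fin 2 → ℝ)) (𝓘(ℝ, ℂ).prod 𝓘(ℝ, ℂ)) metricTN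
      complexStructureTN metricSJ complexStructureSJ identification := by
  refine ⟨contMDiff_identification, fun u A B => ?_, fun u A => ?_⟩
  · rw [(hasMFDerivAt_identification u).mfderiv]
    exact metricSJ_identificationL u A B
  · rw [(hasMFDerivAt_identification u).mfderiv]
    exact complexStructureSJ_identificationL u A

/-- The group of holomorphic isometries of the Siegel-Jacobi space. -/
noncomputable def holomorphicIsometriesSJ : Subgroup (Equiv.Perm (ℍ × ℂ)) :=
  holomorphicIsometryGroup (𝓘(ℝ, ℂ).prod 𝓘(ℝ, ℂ)) metricSJ complexStructureSJ

/-- This moves the whole problem to `ℍ × ℂ`. -/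
theorem mem_holomorphicIsometriesTN {φ : Equiv.Perm TN} :
    φ ∈ holomorphicIsometriesTN ↔ identification.permCongr φ ∈ holomorphicIsometriesSJ := by
  refine ⟨permCongr_mem_holomorphicIsometryGroup isHolomorphicIsometry_identification
    contMDiff_identification_symm, fun h => ?_⟩
  have h' := permCongr_mem_holomorphicIsometryGroup
    (isHolomorphicIsometry_identification.symm contMDiff_identification_symm)
    contMDiff_identification h
  have e : identification.symm.permCongr (identification.permCongr φ) = φ := by
    ext1 x
    simp
  rwa [e] at h'

/-! ## The action of `ASp(2, ℝ)` by holomorphic isometries -/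

/-- The difference `dz - (y / v) dτ` evaluated at a tangent vector to `ℍ × ℂ`. -/
noncomputable def berndtForm (q : ℍ × ℂ) (X : ℂ × ℂ) : ℂ :=
  X.2 - ((q.2.im / q.1.im : ℝ) : ℂ) * X.1

/-- Completing the square in `dz` diagonalizes the metric into two terms that transform by powers of
`cτ + d`. -/
theorem metricSJ_eq (q : ℍ × ℂ) (X Y : ℂ × ℂ) :
    metricSJ q X Y = 1 / 2 * ((X.1 * (starRingEnd ℂ) Y.1).re / q.1.im ^ 2 +
      (berndtForm q X * (starRingEnd ℂ) (berndtForm q Y)).re / q.1.im) := by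
  have hv : q.1.im ≠ 0 := q.1.im_pos.ne'
  unfold metricSJ
  simp [kaehlerBerndtMatrix, realCoords, berndtForm, Matrix.mulVec, dotProduct,
    Fin.sum_univ_succ]
  field_simp
  ring

/-- The automorphy factor `cτ + d`. -/
noncomputable def autFactor (g : ASp) (τ : ℂ) : ℂ := (g.mat 1 0 : ℂ) * τ + (g.mat 1 1 : ℂ)

theorem autFactor_ne_zero (g : ASp) (τ : ℍ) : autFactor g τ ≠ 0 :=
  UpperHalfPlane.denom_ne_zero (g.mat : GL (Fin 2) ℝ) τ

theorem coe_smul_fst (g : ASp) (q : ℍ × ℂ) : ((g • q).1 : ℂ) =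
    ((g.mat 0 0 : ℂ) * q.1 + (g.mat 0 1 : ℂ)) / autFactor g q.1 :=
  coe_specialLinearGroup_apply g.mat q.1

theorem smul_snd (g : ASp) (q : ℍ × ℂ) : (g • q).2 =
    (q.2 + (g.vec 0 : ℂ) * q.1 + (g.vec 1 : ℂ)) / autFactor g q.1 := rfl

theorem det_mat (g : ASp) : (g.mat 0 0 : ℂ) * g.mat 1 1 - g.mat 0 1 * g.mat 1 0 = 1 := by
  have h := Matrix.det_fin_two g.mat.1
  rw [g.mat.2] at h
  exact_mod_cast h.symm

theorem im_smul_fst (g : ASp) (q : ℍ × ℂ) :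
    (g • q).1.im = q.1.im / Complex.normSq (autFactor g q.1) := by
  have hn : Complex.normSq (autFactor g q.1) ≠ 0 := by simpa using autFactor_ne_zero g q.1
  have hd := congrArg Complex.re (det_mat g)
  have h := congrArg Complex.im (coe_smul_fst g q)
  rw [div_eq_mul_inv, Complex.inv_def, ← mul_assoc, Complex.im_mul_ofReal] at h
  rw [← coe_im, h, div_eq_mul_inv]
  congr 1
  simp [autFactor] at hd ⊢
  linear_combination q.1.im * hd

/-- The derivative of the action of `ASp(2, ℝ)` at a point. -/
noncomputable def smulDeriv (g : ASp) (q : ℍ × ℂ) : ℂ × ℂ →L[ℂ] ℂ × ℂ :=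
  (((autFactor g q.1) ^ 2)⁻¹ • ContinuousLinearMap.fst ℂ ℂ ℂ).prod
    ((autFactor g q.1)⁻¹ • (ContinuousLinearMap.snd ℂ ℂ ℂ +
        (g.vec 0 : ℂ) • ContinuousLinearMap.fst ℂ ℂ ℂ) -
      ((g.mat 1 0 : ℂ) * (q.2 + (g.vec 0 : ℂ) * q.1 + (g.vec 1 : ℂ)) *
        ((autFactor g q.1) ^ 2)⁻¹) • ContinuousLinearMap.fst ℂ ℂ ℂ)

theorem hasFDerivAt_smul_coord (g : ASp) (q : ℍ × ℂ) :
    HasFDerivAt (fun p : ℂ × ℂ => (((g.mat 0 0 : ℂ) * p.1 + (g.mat 0 1 : ℂ)) / autFactor g p.1,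
      (p.2 + (g.vec 0 : ℂ) * p.1 + (g.vec 1 : ℂ)) / autFactor g p.1)) (smulDeriv g q)
      (toCoord q) := by
  have hj := autFactor_ne_zero g q.1
  have h1 : HasFDerivAt (fun p : ℂ × ℂ => p.1) (ContinuousLinearMap.fst ℂ ℂ ℂ) (toCoord q) :=
    hasFDerivAt_fst
  have h2 : HasFDerivAt (fun p : ℂ × ℂ => p.2) (ContinuousLinearMap.snd ℂ ℂ ℂ) (toCoord q) :=
    hasFDerivAt_snd
  have hi : HasFDerivAt (fun p : ℂ × ℂ => (autFactor g p.1)⁻¹) _ (toCoord q) :=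
    (hasDerivAt_inv hj).comp_hasFDerivAt (toCoord q)
      (f := fun p : ℂ × ℂ => autFactor g p.1)
      ((h1.const_mul (g.mat 1 0 : ℂ)).add_const (g.mat 1 1 : ℂ))
  have ha := ((h1.const_mul (g.mat 0 0 : ℂ)).add_const (g.mat 0 1 : ℂ)).fun_mul hi
  have hb := ((h2.fun_add (h1.const_mul (g.vec 0 : ℂ))).add_const (g.vec 1 : ℂ)).fun_mul hi
  simp only [div_eq_mul_inv]
  refine (ha.prodMk hb).congr_fderiv ?_
  refine ContinuousLinearMap.ext fun X => Prod.ext ?_ ?_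
  · have hd := det_mat g
    simp only [smulDeriv, toCoord, ContinuousLinearMap.prod_apply, _root_.add_apply,
      _root_.smul_apply, ContinuousLinearMap.coe_fst', smul_eq_mul]
    -- The numerator of the quotient rule for `(aτ + b)/(cτ + d)` is the determinant `1`.
    have hd' : (g.mat 0 0 : ℂ) * autFactor g q.1 -
        (g.mat 1 0 : ℂ) * ((g.mat 0 0 : ℂ) * q.1 + (g.mat 0 1 : ℂ)) = 1 := by
      rw [autFactor]
      linear_combination hd
    field_simp
    linear_combination X.1 * hd'
  · simp only [smulDeriv, toCoord, ContinuousLinearMap.prod_apply, _root_.add_apply,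
      _root_.sub_apply,
      _root_.smul_apply, ContinuousLinearMap.coe_fst', ContinuousLinearMap.coe_snd',
      smul_eq_mul]
    field_simp
    ring

theorem toCoord_comp_smul (g : ASp) : toCoord ∘ (fun q : ℍ × ℂ => g • q) =
    (fun p : ℂ × ℂ => (((g.mat 0 0 : ℂ) * p.1 + (g.mat 0 1 : ℂ)) / autFactor g p.1,
      (p.2 + (g.vec 0 : ℂ) * p.1 + (g.vec 1 : ℂ)) / autFactor g p.1)) ∘ toCoord :=
  funext fun q => Prod.ext (coe_smul_fst g q) (smul_snd g q)

theorem hasMFDerivAt_smul (g : ASp) (q : ℍ × ℂ) :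
    HasMFDerivAt (𝓘(ℝ, ℂ).prod 𝓘(ℝ, ℂ)) (𝓘(ℝ, ℂ).prod 𝓘(ℝ, ℂ)) (fun q : ℍ × ℂ => g • q) q
      ((smulDeriv g q).restrictScalars ℝ) := by
  apply hasMFDerivAt_of_toCoord
  rw [toCoord_comp_smul]
  exact HasMFDerivAt.comp q
    ((hasFDerivAt_smul_coord g q).restrictScalars ℝ).hasMFDerivAt (hasMFDerivAt_toCoord q)

theorem contMDiff_smul_asp (g : ASp) :
    ContMDiff (𝓘(ℝ, ℂ).prod 𝓘(ℝ, ℂ)) (𝓘(ℝ, ℂ).prod 𝓘(ℝ, ℂ)) ∞ (fun q : ℍ × ℂ => g • q) := by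
  apply contMDiff_of_toCoord
  rw [toCoord_comp_smul]
  intro q
  refine ContMDiffAt.comp q ?_ (contMDiff_toCoord q)
  rw [contMDiffAt_iff_contDiffAt]
  have hj : (g.mat 1 0 : ℂ) * (toCoord q).1 + (g.mat 1 1 : ℂ) ≠ 0 := autFactor_ne_zero g q.1
  unfold autFactor
  refine ContDiffAt.restrict_scalars ℝ (𝕜' := ℂ) ?_
  fun_prop (disch := exact hj)

theorem berndtForm_smulDeriv (g : ASp) (q : ℍ × ℂ) (X : ℂ × ℂ) :
    berndtForm (g • q) (smulDeriv g q X) = berndtForm q X / autFactor g q.1 := by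
  have hj := autFactor_ne_zero g q.1
  have hv : q.1.im ≠ 0 := q.1.im_pos.ne'
  set w : ℂ := q.2 + (g.vec 0 : ℂ) * q.1 + (g.vec 1 : ℂ) with hw
  have hn : Complex.normSq (autFactor g q.1) ≠ 0 := by simpa using hj
  have e : (g • q).2.im / (g • q).1.im =
      (w * (starRingEnd ℂ) (autFactor g q.1)).im / q.1.im := by
    rw [im_smul_fst, smul_snd, ← hw, div_eq_mul_inv w, Complex.inv_def, ← mul_assoc,
      Complex.im_mul_ofReal]
    field_simp
  -- Writing `j` for the automorphy factor, this follows from `λ v = Im w - y`, `c v = Im j` and the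
  -- identity `(Im w) j - (Im j) w = Im (w j̄)`.
  have key : ((g.vec 0 : ℂ) * autFactor g q.1 - (g.mat 1 0 : ℂ) * w) * q.1.im -
      (w * (starRingEnd ℂ) (autFactor g q.1)).im = -(q.2.im : ℂ) * autFactor g q.1 := by
    apply Complex.ext <;> simp [hw, autFactor] <;> ring
  have hv' : (q.1.im : ℂ) ≠ 0 := by exact_mod_cast hv
  rw [berndtForm, berndtForm, e]
  simp only [smulDeriv, ContinuousLinearMap.prod_apply, _root_.add_apply,
      _root_.sub_apply,
      _root_.smul_apply, ContinuousLinearMap.coe_fst', ContinuousLinearMap.coe_snd',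
      smul_eq_mul, ← hw]
  push_cast
  field_simp
  linear_combination X.1 * key

theorem metricSJ_smulDeriv (g : ASp) (q : ℍ × ℂ) (X Y : ℂ × ℂ) :
    metricSJ (g • q) (smulDeriv g q X) (smulDeriv g q Y) = metricSJ q X Y := by
  have hj := autFactor_ne_zero g q.1
  have hv : q.1.im ≠ 0 := q.1.im_pos.ne'
  have hn : Complex.normSq (autFactor g q.1) ≠ 0 := by simpa using hj
  have hd : ∀ a b k : ℂ, (a / k * (starRingEnd ℂ) (b / k)).re =
      (a * (starRingEnd ℂ) b).re / Complex.normSq k := by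
    intro a b k
    rw [map_div₀, div_mul_div_comm, Complex.mul_conj k, Complex.div_ofReal_re]
  have h1 : ∀ X, (smulDeriv g q X).1 = X.1 / autFactor g q.1 ^ 2 := fun X => by
    simp [smulDeriv, div_eq_mul_inv, mul_comm]
  rw [metricSJ_eq, metricSJ_eq, berndtForm_smulDeriv, berndtForm_smulDeriv, im_smul_fst, h1, h1,
    hd, hd, map_pow]
  field_simp

theorem isHolomorphicIsometry_smul (g : ASp) :
    IsHolomorphicIsometry (𝓘(ℝ, ℂ).prod 𝓘(ℝ, ℂ)) (𝓘(ℝ, ℂ).prod 𝓘(ℝ, ℂ)) metricSJ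
      complexStructureSJ metricSJ complexStructureSJ (fun q : ℍ × ℂ => g • q) := by
  refine ⟨contMDiff_smul_asp g, fun q X Y => ?_, fun q X => ?_⟩
  · rw [(hasMFDerivAt_smul g q).mfderiv]
    exact metricSJ_smulDeriv g q X Y
  · rw [(hasMFDerivAt_smul g q).mfderiv]
    exact (smulDeriv g q).map_smul Complex.I X

theorem toPerm_mem_holomorphicIsometriesSJ (g : ASp) :
    MulAction.toPerm g ∈ holomorphicIsometriesSJ :=
  mem_holomorphicIsometryGroup.2 ⟨isHolomorphicIsometry_smul g, contMDiff_smul_asp g⁻¹⟩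

/-! ## Holomorphic functions on the upper half-plane -/

theorem isPreconnected_im_pos : IsPreconnected {z : ℂ | 0 < z.im} :=
  (convex_halfSpace_im_gt 0).isPreconnected

theorem isOpen_im_pos : IsOpen {z : ℂ | 0 < z.im} :=
  isOpen_lt continuous_const Complex.continuous_im

/-- Maximum modulus principle: every point is a maximum of the norm. -/
theorem eq_of_norm_eq_one_of_differentiableOn {f : ℂ → ℂ}
    (hf : DifferentiableOn ℂ f {z | 0 < z.im}) (h : ∀ z, 0 < z.im → ‖f z‖ = 1) {z w : ℂ}
    (hz : 0 < z.im) (hw : 0 < w.im) : f z = f w :=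
  Complex.eqOn_of_isPreconnected_of_isMaxOn_norm isPreconnected_im_pos isOpen_im_pos hf hw
    (fun x hx => by
      change ‖f x‖ ≤ ‖f w‖
      rw [h x hx, h w hw]) hz

theorem eq_of_im_eq_zero_of_differentiableOn {f : ℂ → ℂ}
    (hf : DifferentiableOn ℂ f {z | 0 < z.im}) (h : ∀ z, 0 < z.im → (f z).im = 0) {z w : ℂ}
    (hz : 0 < z.im) (hw : 0 < w.im) : f z = f w := by
  obtain ⟨c, hc⟩ := (hf.analyticOnNhd isOpen_im_pos).eq_const_of_im_eq_const h isOpen_im_pos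
    ⟨⟨z, hz⟩, isPreconnected_im_pos⟩
  rw [hc z hz, hc w hw]

/-- An entire function with values in the upper half-plane is constant. -/
theorem apply_eq_apply_of_differentiable_coe {h : ℂ → ℍ}
    (hd : Differentiable ℂ fun z => (h z : ℂ)) (z w : ℂ) : h z = h w := by
  have hi : ∀ z, 1 ≤ ‖(h z : ℂ) + Complex.I‖ := fun z => by
    refine le_trans ?_ (Complex.abs_im_le_norm _)
    rw [Complex.add_im, Complex.I_im, coe_im]
    exact (by linarith [(h z).im_pos] : 1 ≤ (h z).im + 1).trans (le_abs_self _)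
  have hne : ∀ z, (h z : ℂ) + Complex.I ≠ 0 := fun z e => by
    have := hi z
    rw [e, norm_zero] at this
    linarith
  -- Since `|h + i| ≥ 1`, the entire function `1/(h + i)` is bounded and Liouville applies.
  have hb : Bornology.IsBounded (Set.range fun z => ((h z : ℂ) + Complex.I)⁻¹) := by
    refine (Metric.isBounded_closedBall (x := (0 : ℂ)) (r := 1)).subset ?_
    rintro _ ⟨z, rfl⟩
    rw [mem_closedBall_zero_iff, norm_inv]
    exact inv_le_one_of_one_le₀ (hi z)
  have := ((hd.add_const Complex.I).fun_inv hne).apply_eq_apply_of_bounded hb z w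
  exact UpperHalfPlane.ext (add_right_cancel (inv_injective this))

/-! ### Automorphisms of the upper half-plane through the unit disc -/

/-- The Cayley transform from the upper half-plane to the unit disc. -/
noncomputable def cayley (z : ℂ) : ℂ := (z - Complex.I) / (z + Complex.I)

/-- The inverse of the Cayley transform. -/
noncomputable def cayleyInv (w : ℂ) : ℂ := Complex.I * (1 + w) / (1 - w)

theorem add_I_ne_zero {z : ℂ} (hz : 0 < z.im) : z + Complex.I ≠ 0 := fun h => by
  have := congrArg Complex.im h
  simp at this
  linarith

theorem one_sub_ne_zero_of_norm_lt_one {w : ℂ} (hw : ‖w‖ < 1) : 1 - w ≠ 0 := fun h => by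
  rw [← sub_eq_zero.1 h] at hw
  simp at hw

theorem norm_cayley_lt_one {z : ℂ} (hz : 0 < z.im) : ‖cayley z‖ < 1 := by
  have h := add_I_ne_zero hz
  rw [cayley, norm_div, div_lt_one (norm_pos_iff.2 h)]
  apply lt_of_pow_lt_pow_left₀ 2 (norm_nonneg _)
  rw [← Complex.normSq_eq_norm_sq, ← Complex.normSq_eq_norm_sq, Complex.normSq_apply,
    Complex.normSq_apply]
  simp
  nlinarith

theorem cayleyInv_cayley {z : ℂ} (hz : 0 < z.im) : cayleyInv (cayley z) = z := by
  have h := add_I_ne_zero hz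
  have h' : 1 - cayley z ≠ 0 := one_sub_ne_zero_of_norm_lt_one (norm_cayley_lt_one hz)
  rw [cayleyInv, div_eq_iff h', cayley]
  field_simp
  ring

theorem cayley_cayleyInv {w : ℂ} (hw : ‖w‖ < 1) : cayley (cayleyInv w) = w := by
  have h := one_sub_ne_zero_of_norm_lt_one hw
  have e1 : cayleyInv w - Complex.I = 2 * Complex.I * w / (1 - w) := by
    rw [cayleyInv]
    field_simp
    ring
  have e2 : cayleyInv w + Complex.I = 2 * Complex.I / (1 - w) := by
    rw [cayleyInv]
    field_simp
    ring
  rw [cayley, e1, e2]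
  field_simp [Complex.I_ne_zero]

theorem im_cayleyInv_pos {w : ℂ} (hw : ‖w‖ < 1) : 0 < (cayleyInv w).im := by
  have h := one_sub_ne_zero_of_norm_lt_one hw
  have hn : 0 < Complex.normSq (1 - w) := Complex.normSq_pos.2 h
  have hw2 : Complex.normSq w < 1 := by
    rw [Complex.normSq_eq_norm_sq]
    nlinarith [norm_nonneg w]
  have e : (cayleyInv w).im = (1 - Complex.normSq w) / Complex.normSq (1 - w) := by
    rw [cayleyInv, div_eq_mul_inv, Complex.inv_def, ← mul_assoc, Complex.im_mul_ofReal,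
      ← div_eq_mul_inv, Complex.normSq_apply w]
    congr 1
    simp
    ring
  rw [e]
  exact div_pos (by linarith) hn

theorem cayley_injective (τ τ' : ℍ) (h : cayley τ = cayley τ') : τ = τ' := by
  apply UpperHalfPlane.ext
  rw [← cayleyInv_cayley τ.im_pos, h, cayleyInv_cayley τ'.im_pos]

theorem cayley_I : cayley Complex.I = 0 := by simp [cayley]

/-- A self-map of the upper half-plane, transported to the unit disc. -/
noncomputable def discMap (α : ℍ → ℍ) (w : ℂ) : ℂ := cayley (α (ofComplex (cayleyInv w)))

theorem discMap_cayley (α : ℍ → ℍ) (τ : ℍ) : discMap α (cayley τ) = cayley (α τ) := by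
  rw [discMap, cayleyInv_cayley τ.im_pos, ofComplex_apply]

theorem norm_discMap_lt_one (α : ℍ → ℍ) (w : ℂ) : ‖discMap α w‖ < 1 :=
  norm_cayley_lt_one (α _).im_pos

theorem differentiableOn_discMap {α : ℍ → ℍ}
    (hα : DifferentiableOn ℂ (fun z => (α (ofComplex z) : ℂ)) {z | 0 < z.im}) :
    DifferentiableOn ℂ (discMap α) (Metric.ball 0 1) := by
  have h1 : DifferentiableOn ℂ cayleyInv (Metric.ball 0 1) := fun w hw => by
    have h := one_sub_ne_zero_of_norm_lt_one (mem_ball_zero_iff.1 hw)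
    unfold cayleyInv
    exact DifferentiableAt.differentiableWithinAt (by fun_prop (disch := exact h))
  have h2 : DifferentiableOn ℂ cayley {z | 0 < z.im} := fun z hz => by
    have h := add_I_ne_zero hz
    unfold cayley
    exact DifferentiableAt.differentiableWithinAt (by fun_prop (disch := exact h))
  exact h2.comp (hα.comp h1 fun w hw => im_cayleyInv_pos (mem_ball_zero_iff.1 hw))
    fun w _ => (α _).im_pos

theorem discMap_zero {α : ℍ → ℍ} (h : α I = I) : discMap α 0 = 0 := by
  have := discMap_cayley α I
  rwa [h, coe_I, cayley_I] at this

/-- The Schwarz lemma, carried over from the disc. -/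
theorem norm_cayley_apply_le {α : ℍ → ℍ}
    (hα : DifferentiableOn ℂ (fun z => (α (ofComplex z) : ℂ)) {z | 0 < z.im}) (h : α I = I)
    (τ : ℍ) : ‖cayley (α τ)‖ ≤ ‖cayley τ‖ := by
  rw [← discMap_cayley]
  exact Complex.norm_le_norm_of_mapsTo_ball (differentiableOn_discMap hα)
    (fun w _ => mem_closedBall_zero_iff.2 (norm_discMap_lt_one α w).le) (discMap_zero h)
    (norm_cayley_lt_one τ.im_pos)

/-- An automorphism of the upper half-plane fixing `i` is a rotation of the disc. -/
theorem exists_cayley_apply_eq_mul {α β : ℍ → ℍ}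
    (hα : DifferentiableOn ℂ (fun z => (α (ofComplex z) : ℂ)) {z | 0 < z.im})
    (hβ : DifferentiableOn ℂ (fun z => (β (ofComplex z) : ℂ)) {z | 0 < z.im})
    (hβα : ∀ τ, β (α τ) = τ) (h : α I = I) :
    ∃ C : ℂ, ‖C‖ = 1 ∧ ∀ τ, cayley (α τ) = C * cayley τ := by
  have hβI : β I = I := by rw [← h, hβα, h]
  -- The Schwarz lemma for both `α` and its left inverse `β` gives equality.
  have hn : ∀ τ, ‖cayley (α τ)‖ = ‖cayley τ‖ := fun τ => by
    refine le_antisymm (norm_cayley_apply_le hα h τ) ?_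
    have := norm_cayley_apply_le hβ hβI (α τ)
    rwa [hβα] at this
  have h2 : ‖(1 / 2 : ℂ)‖ < 1 := by norm_num
  have h0 := discMap_zero h
  -- Equality at one nonzero point of the disc suffices for rigidity, and `1/2` is an arbitrary
  -- choice. The right side `1 / 1` is the ratio of the two radii.
  have hs : ‖dslope (discMap α) 0 (1 / 2)‖ = 1 / 1 := by
    have e := discMap_cayley α (ofComplex (cayleyInv (1 / 2)))
    have e' := hn (ofComplex (cayleyInv (1 / 2)))
    rw [← e] at e'
    rw [ofComplex_apply_of_im_pos (im_cayleyInv_pos h2)] at e'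
    change ‖discMap α (cayley (cayleyInv (1 / 2)))‖ = ‖cayley (cayleyInv (1 / 2))‖ at e'
    rw [cayley_cayleyInv h2] at e'
    rw [dslope_of_ne _ (by norm_num), slope_def_field, h0, sub_zero, sub_zero, norm_div, e',
      div_self (by norm_num)]
    norm_num
  obtain ⟨C, hC, hE⟩ := Complex.affine_of_mapsTo_ball_of_exists_norm_dslope_eq_div'
    (differentiableOn_discMap hα)
    (fun w _ => by
      rw [h0]
      exact mem_closedBall_zero_iff.2 (norm_discMap_lt_one α w).le)
    ⟨1 / 2, mem_ball_zero_iff.2 h2, hs⟩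
  refine ⟨C, by simpa using hC, fun τ => ?_⟩
  have := hE (mem_ball_zero_iff.2 (norm_cayley_lt_one τ.im_pos))
  rw [discMap_cayley] at this
  simpa [h0, mul_comm] using this

/-- The rotation of the upper half-plane about `i` through the angle `2t`. -/
noncomputable def rotationSL (t : ℝ) : SL(2, ℝ) :=
  ⟨!![Real.cos t, Real.sin t; -Real.sin t, Real.cos t], by
    rw [Matrix.det_fin_two_of]
    nlinarith [Real.sin_sq_add_cos_sq t]⟩

theorem cayley_rotationSL_smul (t : ℝ) (τ : ℍ) :
    cayley (rotationSL t • τ : ℍ) = Complex.exp (2 * t * Complex.I) * cayley τ := by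
  have hj : (-Complex.sin t) * τ + Complex.cos t ≠ 0 := by
    have := autFactor_ne_zero ⟨rotationSL t, 0⟩ τ
    simpa [autFactor, rotationSL] using this
  have e : ((rotationSL t • τ : ℍ) : ℂ) =
      (Complex.cos t * τ + Complex.sin t) / ((-Complex.sin t) * τ + Complex.cos t) := by
    rw [coe_specialLinearGroup_apply]
    simp [rotationSL]
  have h1 := add_I_ne_zero τ.im_pos
  have h1' := add_I_ne_zero (rotationSL t • τ).im_pos
  have hI := Complex.I_sq
  have hsc := Complex.sin_sq_add_cos_sq t
  have h2 : Complex.exp (2 * t * Complex.I) =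
      (Complex.cos t + Complex.sin t * Complex.I) ^ 2 := by
    rw [← Complex.exp_mul_I, ← Complex.exp_nat_mul]
    congr 1
    push_cast
    ring
  -- Dividing this by the next identity gives the factor `(cos t + i sin t)/(cos t - i sin t) = (cos
  -- t + i sin t)²`.
  have e1 : ((rotationSL t • τ : ℍ) : ℂ) - Complex.I =
      (Complex.cos t + Complex.sin t * Complex.I) * (τ - Complex.I) /
        ((-Complex.sin t) * τ + Complex.cos t) := by
    rw [e, eq_div_iff hj, sub_mul, div_mul_cancel₀ _ hj]
    linear_combination Complex.sin t * hI
  have e2 : ((rotationSL t • τ : ℍ) : ℂ) + Complex.I =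
      (Complex.cos t - Complex.sin t * Complex.I) * (τ + Complex.I) /
        ((-Complex.sin t) * τ + Complex.cos t) := by
    rw [e, eq_div_iff hj, add_mul, div_mul_cancel₀ _ hj]
    linear_combination Complex.sin t * hI
  rw [h2, cayley, cayley, ← mul_div_assoc, div_eq_div_iff h1' h1, e1, e2]
  linear_combination (-(Complex.cos t + Complex.sin t * Complex.I) * (τ - Complex.I) *
    (τ + Complex.I) / ((-Complex.sin t) * τ + Complex.cos t)) * hsc +
    ((Complex.cos t + Complex.sin t * Complex.I) * (τ - Complex.I) *
    (τ + Complex.I) / ((-Complex.sin t) * τ + Complex.cos t)) * Complex.sin t ^ 2 * hI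

/-- An automorphism of the upper half-plane is a Möbius transformation. -/
theorem exists_smul_eq_of_differentiableOn {α β : ℍ → ℍ}
    (hα : DifferentiableOn ℂ (fun z => (α (ofComplex z) : ℂ)) {z | 0 < z.im})
    (hβ : DifferentiableOn ℂ (fun z => (β (ofComplex z) : ℂ)) {z | 0 < z.im})
    (hβα : ∀ τ, β (α τ) = τ) : ∃ M : SL(2, ℝ), ∀ τ, α τ = M • τ := by
  have hsmul : ∀ M : SL(2, ℝ),
      DifferentiableOn ℂ (fun z => ((M • ofComplex z : ℍ) : ℂ)) {z | 0 < z.im} := fun M =>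
    mdifferentiable_iff.1 (mdifferentiable_coe.comp
      (mdifferentiable_smul (g := (M : GL (Fin 2) ℝ)) (by simp)))
  have hcomp : ∀ α β : ℍ → ℍ,
      DifferentiableOn ℂ (fun z => (α (ofComplex z) : ℂ)) {z | 0 < z.im} →
      DifferentiableOn ℂ (fun z => (β (ofComplex z) : ℂ)) {z | 0 < z.im} →
      DifferentiableOn ℂ (fun z => (α (β (ofComplex z)) : ℂ)) {z | 0 < z.im} := by
    intro α β hα hβ
    have := hα.comp hβ fun z _ => (β (ofComplex z)).im_pos
    simpa [Function.comp_def] using this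
  -- By transitivity one may assume that `i` is fixed.
  obtain ⟨N, hN⟩ := MulAction.exists_smul_eq SL(2, ℝ) (α I) I
  obtain ⟨C, hC, h⟩ := exists_cayley_apply_eq_mul (α := fun τ => N • α τ)
    (β := fun τ => β (N⁻¹ • τ)) (hcomp _ _ (hsmul N) hα) (hcomp _ _ hβ (hsmul N⁻¹))
    (fun τ => by rw [inv_smul_smul, hβα]) hN
  -- The angle is halved because `rotationSL t` multiplies the disc coordinate by `exp (2it)`.
  refine ⟨N⁻¹ * rotationSL (Complex.arg C / 2), fun τ => ?_⟩
  rw [mul_smul, eq_inv_smul_iff]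
  apply cayley_injective
  rw [h, cayley_rotationSL_smul]
  congr 1
  have := Complex.norm_mul_exp_arg_mul_I C
  rw [hC, Complex.ofReal_one, one_mul] at this
  conv_lhs => rw [← this]
  push_cast
  rw [mul_div_cancel₀ _ two_ne_zero]

/-! ## Holomorphic isometries of the Siegel-Jacobi space -/

/-- Holomorphic isometries of `ℍ × ℂ` have complex linear derivatives. -/
theorem IsHolomorphicIsometry.exists_hasFDerivAt {ψ : ℍ × ℂ → ℍ × ℂ}
    (h : IsHolomorphicIsometry (𝓘(ℝ, ℂ).prod 𝓘(ℝ, ℂ)) (𝓘(ℝ, ℂ).prod 𝓘(ℝ, ℂ)) metricSJ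
      complexStructureSJ metricSJ complexStructureSJ ψ) (q : ℍ × ℂ) :
    ∃ D : ℂ × ℂ →L[ℂ] ℂ × ℂ, HasFDerivAt (toCoord ∘ ψ ∘ ofCoord) D (toCoord q) ∧
      ∀ X Y, metricSJ (ψ q) (D X) (D Y) = metricSJ q X Y := by
  obtain ⟨h1, h2, h3⟩ := h
  have hd := hasFDerivAt_coord (h1.mdifferentiable (by simp) q).hasMFDerivAt
  have hg : ∃ L : ℂ × ℂ →L[ℝ] ℂ × ℂ, HasFDerivAt (toCoord ∘ ψ ∘ ofCoord) L (toCoord q) ∧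
      (∀ X Y, metricSJ (ψ q) (L X) (L Y) = metricSJ q X Y) ∧
      ∀ X, L (Complex.I • X) = Complex.I • L X :=
    ⟨_, hd, h2 q, h3 q⟩
  obtain ⟨L, hL, hm, hI⟩ := hg
  -- A real linear map commuting with `i` is complex linear.
  have hc : ∀ (c : ℂ) (X : ℂ × ℂ), L (c • X) = c • L X := by
    intro c X
    have e : ∀ Y : ℂ × ℂ, c • Y = c.re • Y + c.im • (Complex.I • Y) := fun Y => by
      conv_lhs => rw [← Complex.re_add_im c]
      rw [add_smul, mul_smul]
      rfl
    rw [e X, e (L X), map_add, map_smul, map_smul, hI]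
  let D : ℂ × ℂ →L[ℂ] ℂ × ℂ :=
    { toFun := L
      map_add' := L.map_add
      map_smul' := hc
      cont := L.continuous }
  exact ⟨D, hasFDerivAt_of_restrictScalars ℝ hL rfl, hm⟩

theorem differentiable_coord_snd {ψ : ℍ × ℂ → ℍ × ℂ}
    (h : ∀ q, ∃ D : ℂ × ℂ →L[ℂ] ℂ × ℂ, HasFDerivAt (toCoord ∘ ψ ∘ ofCoord) D (toCoord q)) (τ : ℍ) :
    Differentiable ℂ fun z => toCoord (ψ (τ, z)) := by
  intro z
  obtain ⟨D, hD⟩ := h (τ, z)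
  have hi : DifferentiableAt ℂ (fun z : ℂ => ((τ : ℂ), z)) z := by fun_prop
  have := DifferentiableAt.comp z (f := fun z : ℂ => ((τ : ℂ), z)) hD.differentiableAt hi
  simpa [Function.comp_def, ofCoord] using this

theorem differentiableOn_coord_fst {ψ : ℍ × ℂ → ℍ × ℂ}
    (h : ∀ q, ∃ D : ℂ × ℂ →L[ℂ] ℂ × ℂ, HasFDerivAt (toCoord ∘ ψ ∘ ofCoord) D (toCoord q)) (z : ℂ) :
    DifferentiableOn ℂ (fun t => toCoord (ψ (ofComplex t, z))) {t | 0 < t.im} := by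
  intro t ht
  obtain ⟨D, hD⟩ := h (⟨t, ht⟩, z)
  have hi : DifferentiableAt ℂ (fun t : ℂ => (t, z)) t := by fun_prop
  exact (DifferentiableAt.comp t (f := fun t : ℂ => (t, z)) hD.differentiableAt
    hi).differentiableWithinAt

/-- The first component of a holomorphic self-map of `ℍ × ℂ` depends on `τ` only. -/
theorem fst_apply_eq {ψ : ℍ × ℂ → ℍ × ℂ}
    (h : ∀ q, ∃ D : ℂ × ℂ →L[ℂ] ℂ × ℂ, HasFDerivAt (toCoord ∘ ψ ∘ ofCoord) D (toCoord q))
    (τ : ℍ) (z w : ℂ) : (ψ (τ, z)).1 = (ψ (τ, w)).1 :=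
  apply_eq_apply_of_differentiable_coe (h := fun z => (ψ (τ, z)).1)
    (fun z => (differentiable_coord_snd h τ z).fst) z w

theorem metricSJ_self (q : ℍ × ℂ) (X : ℂ × ℂ) :
    metricSJ q X X = 1 / 2 * (‖X.1‖ ^ 2 / q.1.im ^ 2 + ‖berndtForm q X‖ ^ 2 / q.1.im) := by
  rw [metricSJ_eq, Complex.mul_conj, Complex.mul_conj, Complex.ofReal_re, Complex.ofReal_re,
    Complex.normSq_eq_norm_sq, Complex.normSq_eq_norm_sq]

/-- A holomorphic isometry of `ℍ × ℂ` over the identity of `ℍ` is given by an element of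
`ASp(2, ℝ)`. -/
theorem exists_smul_eq_of_fst_eq {ψ : ℍ × ℂ → ℍ × ℂ}
    (h : ∀ q, ∃ D : ℂ × ℂ →L[ℂ] ℂ × ℂ, HasFDerivAt (toCoord ∘ ψ ∘ ofCoord) D (toCoord q) ∧
      ∀ X Y, metricSJ (ψ q) (D X) (D Y) = metricSJ q X Y)
    (h1 : ∀ q, (ψ q).1 = q.1) : ∃ g : ASp, ∀ q, ψ q = g • q := by
  have h' := fun q => (h q).imp fun D hD => hD.1
  -- Over the identity of `ℍ` both `v` and the `dτ` term of the metric are preserved, so the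
  -- isometry condition reduces to preserving the norm of `berndtForm`.
  have key : ∀ q, ∃ D : ℂ × ℂ →L[ℂ] ℂ, HasFDerivAt (fun p => (ψ (ofCoord p)).2) D (toCoord q) ∧
      ∀ X, ‖D X - (((ψ q).2.im / q.1.im : ℝ) : ℂ) * X.1‖ = ‖berndtForm q X‖ := by
    intro q
    obtain ⟨D, hD, hm⟩ := h q
    have hf : HasFDerivAt (fun p : ℂ × ℂ => p.1) ((ContinuousLinearMap.fst ℂ ℂ ℂ).comp D)
        (toCoord q) := by
      refine hD.fst.congr_of_eventuallyEq ?_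
      filter_upwards [toCoord_comp_ofCoord_eventuallyEq (p := toCoord q) q.1.im_pos] with p hp
      have hp' := congrArg Prod.fst hp
      simp only [Function.comp_apply, toCoord, h1]
      exact hp'.symm
    have e := hf.unique hasFDerivAt_fst
    have e' : ∀ X, (D X).1 = X.1 := fun X => congrArg (fun L => L X) e
    refine ⟨(ContinuousLinearMap.snd ℂ ℂ ℂ).comp D, hD.snd, fun X => ?_⟩
    have hX := hm X X
    have hv := q.1.im_pos
    rw [metricSJ_self, metricSJ_self, e', h1] at hX
    have hX' : ‖berndtForm (ψ q) (D X)‖ ^ 2 = ‖berndtForm q X‖ ^ 2 := by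
      have : ‖berndtForm (ψ q) (D X)‖ ^ 2 / q.1.im = ‖berndtForm q X‖ ^ 2 / q.1.im := by linarith
      rwa [div_left_inj' hv.ne'] at this
    rw [berndtForm, e', h1] at hX'
    exact (sq_eq_sq₀ (norm_nonneg _) (norm_nonneg _)).1 hX'
  -- the second component is affine in `z`, with a slope of modulus one
  have hz : ∀ τ z, ∃ d : ℂ, ‖d‖ = 1 ∧ HasDerivAt (fun z => (ψ (τ, z)).2) d z := by
    intro τ z
    obtain ⟨D, hD, hm⟩ := key (τ, z)
    refine ⟨D (0, 1), by simpa [berndtForm] using hm (0, 1), ?_⟩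
    have hi : HasDerivAt (fun z : ℂ => ((τ : ℂ), z)) (0, 1) z :=
      (hasDerivAt_const z (τ : ℂ)).prodMk (hasDerivAt_id z)
    have := HasFDerivAt.comp_hasDerivAt z (f := fun z : ℂ => ((τ : ℂ), z)) hD hi
    simpa [Function.comp_def, ofCoord] using this
  have haff : ∀ τ z, (ψ (τ, z)).2 = ((ψ (τ, 1)).2 - (ψ (τ, 0)).2) * z + (ψ (τ, 0)).2 := by
    intro τ
    choose d hd1 hd using hz τ
    have hdiff : Differentiable ℂ fun z => (ψ (τ, z)).2 := fun z => (hd z).differentiableAt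
    have hdd : Differentiable ℂ d := by
      have : d = deriv fun z => (ψ (τ, z)).2 := funext fun z => (hd z).deriv.symm
      rw [this]
      exact fun z => (hdiff.analyticAt z).deriv.differentiableAt
    -- The derivative in `z` is entire of modulus one, hence constant by Liouville.
    have hconst : ∀ z, d z = d 0 := fun z => by
      refine hdd.apply_eq_apply_of_bounded ?_ z 0
      refine (Metric.isBounded_closedBall (x := (0 : ℂ)) (r := 1)).subset ?_
      rintro _ ⟨z, rfl⟩
      exact mem_closedBall_zero_iff.2 (hd1 z).le
    have hc : ∀ z, (ψ (τ, z)).2 - d 0 * z = (ψ (τ, 0)).2 - d 0 * 0 := fun z => by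
      refine is_const_of_deriv_eq_zero (f := fun z => (ψ (τ, z)).2 - d 0 * z) (by fun_prop)
        (fun w => ?_) z 0
      have := (hd w).fun_sub ((hasDerivAt_id w).const_mul (d 0))
      rw [hconst w, mul_one, sub_self] at this
      exact this.deriv
    intro z
    have c1 := hc 1
    have cz := hc z
    linear_combination cz - z * c1
  have hslope : ∀ τ, ‖(ψ (τ, 1)).2 - (ψ (τ, 0)).2‖ = 1 := by
    intro τ
    obtain ⟨d, hd1, hd⟩ := hz τ 0
    have : HasDerivAt (fun z => (ψ (τ, z)).2) ((ψ (τ, 1)).2 - (ψ (τ, 0)).2) 0 := by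
      rw [funext (haff τ)]
      simpa using ((hasDerivAt_id (0 : ℂ)).const_mul ((ψ (τ, 1)).2 - (ψ (τ, 0)).2)).add_const
        ((ψ (τ, 0)).2)
    rw [this.unique hd, hd1]
  -- the slope is constant
  have hdiff : ∀ z : ℂ, DifferentiableOn ℂ (fun t => (ψ (ofComplex t, z)).2) {t | 0 < t.im} :=
    fun z => (differentiableOn_coord_fst h' z).snd
  obtain ⟨a, ha⟩ : ∃ a, ∀ τ, (ψ (τ, 1)).2 - (ψ (τ, 0)).2 = a := by
    refine ⟨(ψ (I, 1)).2 - (ψ (I, 0)).2, fun τ => ?_⟩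
    -- The slope is holomorphic in `τ` and of modulus one.
    have := eq_of_norm_eq_one_of_differentiableOn ((hdiff 1).fun_sub (hdiff 0))
      (fun t _ => hslope _) τ.im_pos I.im_pos
    simpa only [ofComplex_apply] using this
  have hb : ∀ τ z, (ψ (τ, z)).2 = a * z + (ψ (τ, 0)).2 := fun τ z => by rw [← ha τ, ← haff]
  have hna : ‖a‖ = 1 := by rw [← ha I, hslope]
  -- the derivative in the `τ`-direction
  have hτ : ∀ (τ : ℍ) (z : ℂ), HasDerivAt (fun t => (ψ (ofComplex t, 0)).2)
      ((((a * z + (ψ (τ, 0)).2).im / τ.im : ℝ) : ℂ) - a * ((z.im / τ.im : ℝ) : ℂ)) τ := by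
    intro τ z
    obtain ⟨D, hD, hm⟩ := key (τ, z)
    have d1 : HasDerivAt (fun z => (ψ (τ, z)).2) (D (0, 1)) z := by
      have hi : HasDerivAt (fun z : ℂ => ((τ : ℂ), z)) (0, 1) z :=
        (hasDerivAt_const z (τ : ℂ)).prodMk (hasDerivAt_id z)
      have := HasFDerivAt.comp_hasDerivAt z (f := fun z : ℂ => ((τ : ℂ), z)) hD hi
      simpa [Function.comp_def, ofCoord] using this
    have d2 : HasDerivAt (fun z => (ψ (τ, z)).2) a z := by
      rw [funext (hb τ)]
      simpa using ((hasDerivAt_id z).const_mul a).add_const ((ψ (τ, 0)).2)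
    have e1 : D (0, 1) = a := d1.unique d2
    have hi : HasDerivAt (fun t : ℂ => (t, z)) (1, 0) (τ : ℂ) :=
      (hasDerivAt_id _).prodMk (hasDerivAt_const _ _)
    have d3 := HasFDerivAt.comp_hasDerivAt (τ : ℂ) (f := fun t : ℂ => (t, z)) hD hi
    have d4 : HasDerivAt (fun t => a * z + (ψ (ofComplex t, 0)).2) (D (1, 0)) τ := by
      have : (fun t => a * z + (ψ (ofComplex t, 0)).2) =
          (fun p => (ψ (ofCoord p)).2) ∘ fun t : ℂ => (t, z) := funext fun t => (hb _ _).symm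
      rw [this]
      exact d3
    -- The vector `(1, y/v)` spans the kernel of `berndtForm`; its image lies in the kernel at the
    -- image point, which determines `D (1, 0)`.
    have hX := hm (1, ((z.im / τ.im : ℝ) : ℂ))
    have e2 : D (1, ((z.im / τ.im : ℝ) : ℂ)) = D (1, 0) + ((z.im / τ.im : ℝ) : ℂ) * a := by
      rw [← e1, ← smul_eq_mul, ← map_smul, ← map_add]
      simp
    rw [e2, hb τ z] at hX
    simp only [berndtForm, mul_one, sub_self, norm_zero, norm_eq_zero] at hX
    refine ((hasDerivAt_const_add_iff _).1 d4).congr_deriv ?_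
    linear_combination hX
  -- The left side of `hτ` does not involve `z`, so its derivative at `τ = i` is the same for `z`
  -- and for `0`. Taking `z = 1` afterwards shows that `a` is real.
  have hreal : ∀ z : ℂ, ((a * z).im : ℂ) = a * (z.im : ℂ) := by
    intro z
    have e := (hτ I z).unique (hτ I 0)
    simp only [I_im, div_one, mul_zero, zero_add, Complex.zero_im, Complex.ofReal_zero,
      sub_zero, Complex.add_im, Complex.ofReal_add] at e
    linear_combination e
  have haim : a.im = 0 := by simpa using hreal 1
  have hcase : a = 1 ∨ a = -1 := by
    have ear : a = (a.re : ℂ) := by apply Complex.ext <;> simp [haim]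
    rw [ear, Complex.norm_real, Real.norm_eq_abs, abs_eq zero_le_one] at hna
    rw [ear]
    exact_mod_cast hna
  -- the translation part is affine in `τ` with real coefficients
  have hτ0 : ∀ τ : ℍ, HasDerivAt (fun t => (ψ (ofComplex t, 0)).2)
      (((ψ (τ, 0)).2.im / τ.im : ℝ) : ℂ) τ := fun τ => by simpa using hτ τ 0
  -- By `hτ0` the derivative of `f(τ) = (ψ (τ, 0)).2` equals `Im f / Im τ`. It is holomorphic with
  -- real values, hence a real constant `l`; then `f - lτ` has zero imaginary part and is a real
  -- constant `m`.
  obtain ⟨l, hl⟩ : ∃ l : ℝ, ∀ τ : ℍ, (ψ (τ, 0)).2.im = l * τ.im := by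
    have hda := ((hdiff 0).analyticOnNhd isOpen_im_pos).deriv.differentiableOn
    have hd : ∀ τ : ℍ, deriv (fun t => (ψ (ofComplex t, 0)).2) τ =
        (((ψ (τ, 0)).2.im / τ.im : ℝ) : ℂ) := fun τ => (hτ0 τ).deriv
    refine ⟨(ψ (I, 0)).2.im / I.im, fun τ => ?_⟩
    have := eq_of_im_eq_zero_of_differentiableOn hda (fun z hz => by
      have := hd ⟨z, hz⟩
      change deriv (fun t => (ψ (ofComplex t, 0)).2) z = _ at this
      rw [this, Complex.ofReal_im]) τ.im_pos I.im_pos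
    rw [hd τ, hd I, Complex.ofReal_inj] at this
    rw [← this, div_mul_cancel₀ _ τ.im_pos.ne']
  obtain ⟨m, hm⟩ : ∃ m : ℝ, ∀ τ : ℍ, (ψ (τ, 0)).2 = l * τ + m := by
    have hd : DifferentiableOn ℂ (fun t => (ψ (ofComplex t, 0)).2 - l * t) {t | 0 < t.im} :=
      (hdiff 0).fun_sub (by fun_prop)
    have him : ∀ τ : ℍ, ((ψ (τ, 0)).2 - l * τ).im = 0 := fun τ => by simp [hl]
    refine ⟨((ψ (I, 0)).2 - l * (I : ℍ)).re, fun τ => ?_⟩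
    have e := eq_of_im_eq_zero_of_differentiableOn hd (fun z hz => by
      rw [ofComplex_apply_of_im_pos hz]
      exact him ⟨z, hz⟩) τ.im_pos I.im_pos
    simp only [ofComplex_apply] at e
    have e' : ((((ψ (I, 0)).2 - l * (I : ℍ)).re : ℝ) : ℂ) = (ψ (I, 0)).2 - l * (I : ℍ) := by
      apply Complex.ext
      · rfl
      · rw [him, Complex.ofReal_im]
    rw [e', ← e]
    ring
  rcases hcase with rfl | rfl
  · refine ⟨⟨1, ![l, m]⟩, fun q => Prod.ext ?_ ?_⟩
    · rw [h1]
      exact (one_smul _ _).symm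
    · rw [smul_snd, hb q.1 q.2, hm]
      simp [autFactor]
      ring
  -- The matrix `-1` fixes `ℍ` pointwise but has automorphy factor `-1`, which also reverses the
  -- signs of `l` and `m`.
  · refine ⟨⟨-1, ![-l, -m]⟩, fun q => Prod.ext ?_ ?_⟩
    · rw [h1]
      apply UpperHalfPlane.ext
      rw [coe_smul_fst]
      simp [autFactor]
    · rw [smul_snd, hb q.1 q.2, hm]
      simp [autFactor]
      ring

theorem holomorphicIsometriesSJ_eq :
    holomorphicIsometriesSJ = (MulAction.toPermHom ASp (ℍ × ℂ)).range := by
  ext ψ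
  refine ⟨fun hψ => ?_, ?_⟩
  · have hψi := holomorphicIsometriesSJ.inv_mem hψ
    have D := (mem_holomorphicIsometryGroup.1 hψ).1.exists_hasFDerivAt
    have Di := (mem_holomorphicIsometryGroup.1 hψi).1.exists_hasFDerivAt
    have D' := fun q => (D q).imp fun L hL => hL.1
    have Di' := fun q => (Di q).imp fun L hL => hL.1
    obtain ⟨M, hM⟩ := exists_smul_eq_of_differentiableOn
      (α := fun τ => (ψ (τ, 0)).1) (β := fun τ => ((ψ⁻¹ : Equiv.Perm (ℍ × ℂ)) (τ, 0)).1)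
      (differentiableOn_coord_fst D' 0).fst (differentiableOn_coord_fst Di' 0).fst
      (fun τ => by
        -- The first component of `ψ⁻¹` ignores the fibre coordinate, so `0` may be replaced by the
        -- one that makes `ψ⁻¹` undo `ψ`.
        rw [fst_apply_eq Di' _ 0 (ψ (τ, 0)).2]
        simp)
    -- Composing with `(M⁻¹, 0)` makes the first component the identity.
    have hg := mem_holomorphicIsometryGroup.1 (holomorphicIsometriesSJ.mul_mem
      (toPerm_mem_holomorphicIsometriesSJ ⟨M⁻¹, 0⟩) hψ)
    obtain ⟨g, hgq⟩ := exists_smul_eq_of_fst_eq hg.1.exists_hasFDerivAt (fun q => by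
      change M⁻¹ • (ψ q).1 = q.1
      rw [← Prod.mk.eta (p := q), fst_apply_eq D' _ _ 0, hM, inv_smul_smul])
    refine ⟨(⟨M⁻¹, 0⟩ : ASp)⁻¹ * g, ?_⟩
    ext1 q
    change ((⟨M⁻¹, 0⟩ : ASp)⁻¹ * g) • q = ψ q
    rw [mul_smul, ← hgq]
    exact inv_smul_smul (⟨M⁻¹, 0⟩ : ASp) (ψ q)
  · rintro ⟨g, rfl⟩
    exact toPerm_mem_holomorphicIsometriesSJ g

/-! ### Effectiveness and the main theorem -/

theorem toPermHom_asp_injective : Function.Injective (MulAction.toPermHom ASp (ℍ × ℂ)) := by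
  rw [injective_iff_map_eq_one]
  intro g hg
  have hq : ∀ q : ℍ × ℂ, g • q = q := fun q => Equiv.congr_fun hg q
  -- The points over `τ = i` suffice: real and imaginary parts at `z = 0` give the vector, at `z =
  -- 1` the bottom row, and the first component the top row.
  have hz : ∀ z : ℂ, z + (g.vec 0 : ℂ) * Complex.I + (g.vec 1 : ℂ) =
      z * ((g.mat 1 0 : ℂ) * Complex.I + (g.mat 1 1 : ℂ)) := fun z => by
    have := congrArg Prod.snd (hq (I, z))
    rw [smul_snd, div_eq_iff (autFactor_ne_zero _ _)] at this
    exact this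
  have ht : (g.mat 0 0 : ℂ) * Complex.I + (g.mat 0 1 : ℂ) =
      Complex.I * ((g.mat 1 0 : ℂ) * Complex.I + (g.mat 1 1 : ℂ)) := by
    have := congrArg (fun q : ℍ × ℂ => (q.1 : ℂ)) (hq (I, 0))
    simp only [coe_smul_fst] at this
    rw [div_eq_iff (autFactor_ne_zero _ _)] at this
    exact this
  have h0 := hz 0
  have h1 := hz 1
  have v0 : g.vec 0 = 0 := by simpa using congrArg Complex.im h0
  have v1 : g.vec 1 = 0 := by simpa using congrArg Complex.re h0
  have m10 : g.mat 1 0 = 0 := by simpa [v0] using (congrArg Complex.im h1).symm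
  have m11 : g.mat 1 1 = 1 := by simpa [v1] using (congrArg Complex.re h1).symm
  have m00 : g.mat 0 0 = 1 := by simpa [m11] using congrArg Complex.im ht
  have m01 : g.mat 0 1 = 0 := by simpa [m10] using congrArg Complex.re ht
  apply ASp.ext
  · ext i j
    fin_cases i <;> fin_cases j <;> simp [m00, m01, m10, m11, ASp.mat_one]
  · funext i
    fin_cases i <;> simp [v0, v1, ASp.vec_one]

theorem theorem3p11 :
    -- `T𝒩` is the Siegel-Jacobi space
    (ContMDiff 𝓘(ℝ, (Fin 2 → ℝ) × (Fin 2 → ℝ)) (𝓘(ℝ, ℂ).prod 𝓘(ℝ, ℂ)) ∞ identification ∧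
      ContMDiff (𝓘(ℝ, ℂ).prod 𝓘(ℝ, ℂ)) 𝓘(ℝ, (Fin 2 → ℝ) × (Fin 2 → ℝ)) ∞ identification.symm ∧
      (∀ (u : TN) (A B : TangentSpace 𝓘(ℝ, (Fin 2 → ℝ) × (Fin 2 → ℝ)) u),
        metricSJ (identification u)
          (mfderiv 𝓘(ℝ, (Fin 2 → ℝ) × (Fin 2 → ℝ)) (𝓘(ℝ, ℂ).prod 𝓘(ℝ, ℂ)) identification u A)
          (mfderiv 𝓘(ℝ, (Fin 2 → ℝ) × (Fin 2 → ℝ)) (𝓘(ℝ, ℂ).prod 𝓘(ℝ, ℂ)) identification u B)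
        = metricTN u A B) ∧
      ∀ (u : TN) (A : TangentSpace 𝓘(ℝ, (Fin 2 → ℝ) × (Fin 2 → ℝ)) u),
        mfderiv 𝓘(ℝ, (Fin 2 → ℝ) × (Fin 2 → ℝ)) (𝓘(ℝ, ℂ).prod 𝓘(ℝ, ℂ)) identification u
          (complexStructureTN u A)
        = complexStructureSJ (identification u)
          (mfderiv 𝓘(ℝ, (Fin 2 → ℝ) × (Fin 2 → ℝ)) (𝓘(ℝ, ℂ).prod 𝓘(ℝ, ℂ)) identification u A)) ∧
    -- the action of `ASp(2, ℝ)` is effective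
    Function.Injective actionTN ∧
    -- its image in the group of diffeomorphisms is the group of holomorphic isometries
    holomorphicIsometriesTN = actionTN.range := by
  refine ⟨⟨contMDiff_identification, contMDiff_identification_symm,
    isHolomorphicIsometry_identification.2⟩, ?_, ?_⟩
  · exact (identification.symm.permCongrHom.injective).comp toPermHom_asp_injective
  · ext φ
    rw [mem_holomorphicIsometriesTN, holomorphicIsometriesSJ_eq]
    constructor
    · rintro ⟨g, hg⟩
      refine ⟨g, ?_⟩
      change identification.symm.permCongr (MulAction.toPermHom ASp (ℍ × ℂ) g) = φ
      rw [hg]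
      ext1 x
      simp
    · rintro ⟨g, rfl⟩
      refine ⟨g, ?_⟩
      ext1 q
      simp [actionTN]
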